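/- Let $d\in\mathbb N$ and let $\omega:[0,+\infty)\to[0,+\infty)$ be a non-quasianalytic weight function, i.e. a continuous increasing function such that ($\alpha$) there is $L\ge 1$ with $\omega(2t)\le L(\omega(t)+1)$ for all $t\ge 0$; ($\beta$) $\int_1^{+\infty}\omega(t)t^{-2}\,dt<+\infty$; ($\gamma$) there are $a\in\mathbb R$, $b>0$ with $\omega(t)\ge a+b\log(1+t)$ for all $t\ge0$; ($\delta$) $t\mapsto\omega(e^t)$ is convex. Write $\omega(x):=\omega(|x|)$ for vectors $x$, and $\hat u(\xi)=\int u(x)e^{-i\langle x,\xi\rangle}dx$. For $n\in\mathbb N$, let $\mathcal S_\omega(\mathbb R^n)$ be the space of all $u\in L^1(\mathbb R^n)$ with $u,\hat u\in C^\infty(\mathbb R^n)$ such that $\sup_x e^{\lambda\omega(x)}|D^\alpha u(x)|<+\infty$ and $\sup_\xi e^{\lambda\omega(\xi)}|D^\alpha\hat u(\xi)|<+\infty$ for all $\lambda>0$ and all multi-indices $\alpha$, with the locally convex topology given by these suprema as seminorms; let $\mathcal S_\omega'(\mathbb R^n)$ be its dual, the space of continuous linear functionals on $\mathcal S_\omega(\mathbb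 R^n)$, in which a function $g$ is identified with the functional $\varphi\mapsto\int g\varphi$. For $f\in\mathcal S'_\omega(\mathbb R^d)$ let $\operatorname{Wig}f\in\mathcal S'_\omega(\mathbb R^{2d})$ be its Wigner transform, the extension to $\mathcal S_\omega'$ of $\operatorname{Wig}f(x,\xi)=\int_{\mathbb R^d}f(x+\tfrac t2)\,\overline{f(x-\tfrac t2)}\,e^{-i\langle\xi,t\rangle}dt$, that is, $$\langle\operatorname{Wig}f,\Phi\rangle=\Big\langle f_y,\big\langle\overline f_s,\Psi(y,s)\big\rangle\Big\rangle,\qquad \Psi(y,s)=\int_{\mathbb R^d}\Phi\big(\tfrac{y+s}2,\xi\big)e^{-i\langle\xi,y-s\rangle}d\xi,\qquad \Phi\in\mathcal S_\omega(\mathbb R^{2d}),$$ where $\langle\overline f,\psi\rangle=\overline{\langle f,\overline\psi\rangle}$. For $p,q\in[1,+\infty]$ let $L^{p,q}(\mathbb R^{2d})$ be the space of measurable $F$ on $\mathbb R^{2d}$ with $$\|F\|_{L^{p,q}}=\Big(\int_{\mathbb R^d}\Big(\int_{\mathbb R^d}|F(x,\xi)|^p\,dx\Big)^{q/p}d\xi\Big)^{1/q}<+\infty$$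 (with essential suprema when $p$ or $q$ is $+\infty$). Let $p,q\in[1,+\infty]$ and let $f\in\mathcal S'_\omega(\mathbb R^d)$ be such that $\operatorname{Wig}f$ is a function with $$e^{\lambda\omega(x)+\mu\omega(\xi)}\operatorname{Wig}f(x,\xi)\in L^{p,q}(\mathbb R^{2d})\qquad\text{for all }\lambda,\mu>0.$$ Then $f\in\mathcal S_\omega(\mathbb R^d)$. -/

import Mathlib

open MeasureTheory Set
open scoped ENNReal ComplexConjugate

noncomputable section

/-- Non-quasianalytic weight functions `ω : [0, ∞) → [0, ∞)` (in the Beurling setting). Only the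
values of `ω` on `[0, ∞)` matter. -/
structure IsNonquasianalyticWeight (ω : ℝ → ℝ) : Prop where
  continuousOn : ContinuousOn ω (Ici 0)
  monotoneOn : MonotoneOn ω (Ici 0)
  nonneg : ∀ t, 0 ≤ t → 0 ≤ ω t
  alpha : ∃ L : ℝ, 1 ≤ L ∧ ∀ t, 0 ≤ t → ω (2 * t) ≤ L * (ω t + 1)
  beta : IntegrableOn (fun t => ω t / t ^ 2) (Ici 1)
  gamma : ∃ a b : ℝ, 0 < b ∧ ∀ t, 0 ≤ t → a + b * Real.log (1 + t) ≤ ω t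
  delta : ConvexOn ℝ univ (fun t : ℝ => ω (Real.exp t))

section Space

variable {E : Type*} [NormedAddCommGroup E] [InnerProductSpace ℝ E]

/-- `e^{l ω(|x|)} |Dⁿ u(x)|`, where `Dⁿ u(x)` is the full derivative of order `n`; its norm is
comparable with the maximum of `|D^α u(x)|` over the multi-indices `α` with `|α| = n`. -/
def weightedDeriv (ω : ℝ → ℝ) (l : ℝ) (n : ℕ) (u : E → ℂ) (x : E) : ℝ :=
  Real.exp (l * ω ‖x‖) * ‖iteratedFDeriv ℝ n u x‖

theorem weightedDeriv_add_le (ω : ℝ → ℝ) (l : ℝ) (n : ℕ) {u v : E → ℂ} (hu : ContDiff ℝ (⊤ : ℕ∞) u)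
    (hv : ContDiff ℝ (⊤ : ℕ∞) v) (x : E) :
    weightedDeriv ω l n (u + v) x ≤ weightedDeriv ω l n u x + weightedDeriv ω l n v x := by
  have hn : (n : WithTop ℕ∞) ≤ ((⊤ : ℕ∞) : WithTop ℕ∞) := by exact_mod_cast le_top
  unfold weightedDeriv
  rw [iteratedFDeriv_add_apply (hu.of_le hn).contDiffAt (hv.of_le hn).contDiffAt, ← mul_add]
  exact mul_le_mul_of_nonneg_left (norm_add_le _ _) (Real.exp_pos _).le

theorem weightedDeriv_smul (ω : ℝ → ℝ) (l : ℝ) (n : ℕ) (c : ℂ) {u : E → ℂ} (hu : ContDiff ℝ (⊤ : ℕ∞) u)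
    (x : E) : weightedDeriv ω l n (c • u) x = ‖c‖ * weightedDeriv ω l n u x := by
  have hn : (n : WithTop ℕ∞) ≤ ((⊤ : ℕ∞) : WithTop ℕ∞) := by exact_mod_cast le_top
  unfold weightedDeriv
  rw [iteratedFDeriv_const_smul_apply (hu.of_le hn).contDiffAt, norm_smul]
  ring

theorem bddAbove_weightedDeriv_add {ω : ℝ → ℝ} {l : ℝ} {n : ℕ} {u v : E → ℂ}
    (hu : ContDiff ℝ (⊤ : ℕ∞) u) (hv : ContDiff ℝ (⊤ : ℕ∞) v) (bu : BddAbove (range (weightedDeriv ω l n u)))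
    (bv : BddAbove (range (weightedDeriv ω l n v))) :
    BddAbove (range (weightedDeriv ω l n (u + v))) := by
  obtain ⟨A, hA⟩ := bu
  obtain ⟨B, hB⟩ := bv
  refine ⟨A + B, ?_⟩
  rintro _ ⟨x, rfl⟩
  exact (weightedDeriv_add_le ω l n hu hv x).trans
    (add_le_add (hA (mem_range_self x)) (hB (mem_range_self x)))

theorem bddAbove_weightedDeriv_smul {ω : ℝ → ℝ} {l : ℝ} {n : ℕ} (c : ℂ) {u : E → ℂ}
    (hu : ContDiff ℝ (⊤ : ℕ∞) u) (bu : BddAbove (range (weightedDeriv ω l n u))) :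
    BddAbove (range (weightedDeriv ω l n (c • u))) := by
  obtain ⟨A, hA⟩ := bu
  refine ⟨‖c‖ * A, ?_⟩
  rintro _ ⟨x, rfl⟩
  rw [weightedDeriv_smul ω l n c hu x]
  exact mul_le_mul_of_nonneg_left (hA (mem_range_self x)) (norm_nonneg _)

variable [FiniteDimensional ℝ E] [MeasurableSpace E] [BorelSpace E]

/-- The Fourier transform `û(ξ) = ∫ u(x) e^{-i⟨x,ξ⟩} dx` (no factor `2π` in the exponent). -/
def fourierHat (u : E → ℂ) (ξ : E) : ℂ :=
  ∫ x, Complex.exp (-(Complex.I * ((inner ℝ x ξ : ℝ) : ℂ))) * u x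

/-- `u ∈ L¹` with `u, û ∈ C^∞` such that `e^{l ω} D^α u` and `e^{l ω} D^α û` are bounded for all
`l > 0` and all `α`. -/
structure MemBeurling (ω : ℝ → ℝ) (u : E → ℂ) : Prop where
  integrable : Integrable u
  contDiff : ContDiff ℝ (⊤ : ℕ∞) u
  contDiff_hat : ContDiff ℝ (⊤ : ℕ∞) (fourierHat u)
  bdd : ∀ l : ℝ, 0 < l → ∀ n : ℕ, BddAbove (range (weightedDeriv ω l n u))
  bdd_hat : ∀ l : ℝ, 0 < l → ∀ n : ℕ, BddAbove (range (weightedDeriv ω l n (fourierHat u)))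

theorem integrable_exp_mul {u : E → ℂ} (hu : Integrable u) (ξ : E) :
    Integrable (fun x => Complex.exp (-(Complex.I * ((inner ℝ x ξ : ℝ) : ℂ))) * u x) := by
  refine hu.bdd_mul (c := 1) (Continuous.aestronglyMeasurable (by fun_prop)) ?_
  refine Filter.Eventually.of_forall fun x => ?_
  simp [Complex.norm_exp]

theorem fourierHat_add {u v : E → ℂ} (hu : Integrable u) (hv : Integrable v) :
    fourierHat (u + v) = fourierHat u + fourierHat v := by
  funext ξ
  simp only [fourierHat, Pi.add_apply, mul_add]
  exact integral_add (integrable_exp_mul hu ξ) (integrable_exp_mul hv ξ)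

theorem fourierHat_smul (c : ℂ) (u : E → ℂ) : fourierHat (c • u) = c • fourierHat u := by
  funext ξ
  simp only [fourierHat, Pi.smul_apply, smul_eq_mul, mul_left_comm _ c]
  exact integral_const_mul c _

theorem MemBeurling.add {ω : ℝ → ℝ} {u v : E → ℂ} (hu : MemBeurling ω u) (hv : MemBeurling ω v) :
    MemBeurling ω (u + v) := by
  have h := fourierHat_add hu.integrable hv.integrable
  refine ⟨hu.integrable.add hv.integrable, hu.contDiff.add hv.contDiff, ?_, fun l hl n => ?_,
    fun l hl n => ?_⟩
  · rw [h]
    exact hu.contDiff_hat.add hv.contDiff_hat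
  · exact bddAbove_weightedDeriv_add hu.contDiff hv.contDiff (hu.bdd l hl n) (hv.bdd l hl n)
  · rw [h]
    exact bddAbove_weightedDeriv_add hu.contDiff_hat hv.contDiff_hat (hu.bdd_hat l hl n)
      (hv.bdd_hat l hl n)

theorem MemBeurling.smul {ω : ℝ → ℝ} (c : ℂ) {u : E → ℂ} (hu : MemBeurling ω u) :
    MemBeurling ω (c • u) := by
  have h := fourierHat_smul c u
  refine ⟨hu.integrable.smul c, hu.contDiff.const_smul c, ?_, fun l hl n => ?_,
    fun l hl n => ?_⟩
  · rw [h]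
    exact hu.contDiff_hat.const_smul c
  · exact bddAbove_weightedDeriv_smul c hu.contDiff (hu.bdd l hl n)
  · rw [h]
    exact bddAbove_weightedDeriv_smul c hu.contDiff_hat (hu.bdd_hat l hl n)

theorem MemBeurling.zero (ω : ℝ → ℝ) : MemBeurling ω (0 : E → ℂ) := by
  have h : fourierHat (0 : E → ℂ) = 0 := by
    funext ξ
    simp [fourierHat]
  have hb : ∀ (l : ℝ) (n : ℕ), BddAbove (range (weightedDeriv ω l n (0 : E → ℂ))) := by
    intro l n
    refine ⟨0, ?_⟩
    rintro _ ⟨x, rfl⟩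
    simp [weightedDeriv, Pi.zero_def]
  refine ⟨integrable_zero _ _ _, contDiff_const, ?_, fun l _ n => hb l n, fun l _ n => ?_⟩
  · rw [h]
    exact contDiff_const
  · rw [h]
    exact hb l n

variable (ω : ℝ → ℝ) (E)

/-- The functions of the Beurling class, as a subspace of all functions `E → ℂ`. -/
def beurlingSubmodule : Submodule ℂ (E → ℂ) where
  carrier := {u | MemBeurling ω u}
  add_mem' := MemBeurling.add
  zero_mem' := MemBeurling.zero ω
  smul_mem' := fun c _ hu => hu.smul c

/-- The space `𝒮_ω(E)`. (It is a type of its own, so that it does not carry the topology of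
pointwise convergence.) -/
def BeurlingSpace : Type _ := beurlingSubmodule E ω

namespace BeurlingSpace

instance : AddCommGroup (BeurlingSpace E ω) := inferInstanceAs (AddCommGroup (beurlingSubmodule E ω))

instance : Module ℂ (BeurlingSpace E ω) := inferInstanceAs (Module ℂ (beurlingSubmodule E ω))

instance : CoeFun (BeurlingSpace E ω) (fun _ => E → ℂ) := ⟨fun u => u.1⟩

variable {E ω}

theorem memBeurling (u : BeurlingSpace E ω) : MemBeurling ω (u : E → ℂ) := u.2

/-- The seminorm `sup_x e^{l ω(x)} |Dⁿ u(x)|` on `𝒮_ω(E)`, for `l > 0`. -/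
def seminorm (l : {l : ℝ // 0 < l}) (n : ℕ) : Seminorm ℂ (BeurlingSpace E ω) :=
  Seminorm.of (fun u => ⨆ x, weightedDeriv ω l n (u : E → ℂ) x)
    (fun u v => ciSup_le fun x =>
      (weightedDeriv_add_le ω l n u.memBeurling.contDiff v.memBeurling.contDiff x).trans
        (add_le_add (le_ciSup (u.memBeurling.bdd l l.2 n) x)
          (le_ciSup (v.memBeurling.bdd l l.2 n) x)))
    (fun c u => by
      rw [Real.mul_iSup_of_nonneg (norm_nonneg c)]
      exact iSup_congr fun x => weightedDeriv_smul ω l n c u.memBeurling.contDiff x)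

/-- The seminorm `sup_ξ e^{l ω(ξ)} |Dⁿ û(ξ)|` on `𝒮_ω(E)`, for `l > 0`. -/
def seminormHat (l : {l : ℝ // 0 < l}) (n : ℕ) : Seminorm ℂ (BeurlingSpace E ω) :=
  Seminorm.of (fun u => ⨆ ξ, weightedDeriv ω l n (fourierHat (u : E → ℂ)) ξ)
    (fun u v => ciSup_le fun ξ => by
      have h : fourierHat ((u + v : BeurlingSpace E ω) : E → ℂ) = fourierHat u + fourierHat v :=
        fourierHat_add u.memBeurling.integrable v.memBeurling.integrable
      rw [h]
      exact (weightedDeriv_add_le ω l n u.memBeurling.contDiff_hat v.memBeurling.contDiff_hat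
        ξ).trans (add_le_add (le_ciSup (u.memBeurling.bdd_hat l l.2 n) ξ)
          (le_ciSup (v.memBeurling.bdd_hat l l.2 n) ξ)))
    (fun c u => by
      have h : fourierHat ((c • u : BeurlingSpace E ω) : E → ℂ) = c • fourierHat (u : E → ℂ) :=
        fourierHat_smul c u
      rw [h, Real.mul_iSup_of_nonneg (norm_nonneg c)]
      exact iSup_congr fun ξ => weightedDeriv_smul ω l n c u.memBeurling.contDiff_hat ξ)

variable (E ω)

/-- The family of all the seminorms `seminorm l n` and `seminormHat l n`. -/
def seminormFamily : SeminormFamily ℂ (BeurlingSpace E ω)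
    (({l : ℝ // 0 < l} × ℕ) ⊕ ({l : ℝ // 0 < l} × ℕ)) :=
  Sum.elim (fun i => seminorm i.1 i.2) (fun i => seminormHat i.1 i.2)

/-- The locally convex topology of `𝒮_ω(E)` defined by its seminorms. -/
instance : TopologicalSpace (BeurlingSpace E ω) :=
  (seminormFamily E ω).moduleFilterBasis.topology

theorem withSeminorms : WithSeminorms (seminormFamily E ω) := ⟨rfl⟩

end BeurlingSpace

/-- The dual space `𝒮'_ω(E)`: the continuous linear functionals on `𝒮_ω(E)`. -/
abbrev Ultradistribution : Type _ := BeurlingSpace E ω →L[ℂ] ℂ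

variable {E ω}

/-- A functional `T` on `𝒮_ω(E)` is (given by) the function `g` if `T φ = ∫ g φ` for all test
functions `φ`. -/
def IsGivenBy (T : BeurlingSpace E ω → ℂ) (g : E → ℂ) : Prop :=
  ∀ φ : BeurlingSpace E ω, Integrable (fun x => g x * φ x) ∧ T φ = ∫ x, g x * φ x

open Classical in
/-- `⟨f, φ⟩` for a function `φ : E → ℂ` belonging to `𝒮_ω(E)` (and `0` if it does not). -/
def Ultradistribution.pair (f : Ultradistribution E ω) (φ : E → ℂ) : ℂ :=
  if h : MemBeurling ω φ then f ⟨φ, h⟩ else 0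

/-- `⟨f̄, φ⟩`, the value of the complex conjugate `f̄` of `f`, that is, the complex conjugate of
`⟨f, φ̄⟩`. -/
def Ultradistribution.pairConj (f : Ultradistribution E ω) (φ : E → ℂ) : ℂ :=
  conj (f.pair (fun x => conj (φ x)))

/-- For a test function `Φ` of `(x, ξ)`, the test function
`(y, s) ↦ ∫ Φ((y + s)/2, ξ) e^{-i⟨ξ, y - s⟩} dξ`: the partial Fourier transform of `Φ` in `ξ`,
followed by the change of variables `y = x + t/2`, `s = x - t/2`. -/
def wignerTest (Φ : WithLp 2 (E × E) → ℂ) (y s : E) : ℂ :=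
  ∫ ξ, Complex.exp (-(Complex.I * ((inner ℝ ξ (y - s) : ℝ) : ℂ))) *
    Φ (WithLp.toLp 2 ((2⁻¹ : ℝ) • (y + s), ξ))

/-- The Wigner transform `Wig f` of an ultradistribution `f`, as a functional on `𝒮_ω(E × E)`:
`Wig f (x, ξ) = ∫ f(x + t/2) f̄(x - t/2) e^{-i⟨ξ, t⟩} dt` is the partial Fourier transform, from `t`
to `ξ`, of the tensor product `f(y) ⊗ f̄(s)` at `y = x + t/2`, `s = x - t/2`, so that
`⟨Wig f, Φ⟩ = ⟨f_y, ⟨f̄_s, Ψ(y, s)⟩⟩` with the `Ψ` of `wignerTest`. Both arguments `Ψ(y, ·)` and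
`y ↦ ⟨f̄, Ψ(y, ·)⟩` are in `𝒮_ω(E)` when `Φ` is in `𝒮_ω(E × E)`. -/
def Ultradistribution.wigner (f : Ultradistribution E ω)
    (Φ : BeurlingSpace (WithLp 2 (E × E)) ω) : ℂ :=
  f.pair (fun y => f.pairConj (fun s => wignerTest Φ y s))

/-- The mixed norm `‖ξ ↦ ‖F(·, ξ)‖_{L^p}‖_{L^q}`. -/
def mixedNorm (p q : ℝ≥0∞) (F : WithLp 2 (E × E) → ℂ) : ℝ≥0∞ :=
  eLpNorm (fun ξ : E => eLpNorm (fun x : E => F (WithLp.toLp 2 (x, ξ))) p volume) q volume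

/-- The space `L^{p,q}(E × E)`: (almost everywhere) measurable with finite mixed norm. -/
def MemMixedLp (p q : ℝ≥0∞) (F : WithLp 2 (E × E) → ℂ) : Prop :=
  AEStronglyMeasurable F volume ∧ mixedNorm p q F < ∞

end Space

end

/-! ### Weight functions and rapidly decreasing functions -/

namespace IsNonquasianalyticWeight

variable {ω : ℝ → ℝ} {E : Type*} [NormedAddCommGroup E]

/-! Up to a partial Fourier transform and a linear change of variables, `Wig f` is the tensor
product of f and its conjugate, and pairing one factor with a fixed test function recovers f. If f ≠
0, fix χ with ⟨f, χ⟩ ≠ 0. For each test function φ there is an explicit Φ in 𝒮_ω (`crossWigner`)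
whose Ψ(y, s) is π^d φ(y) conj(χ(s)), so that ⟨Wig f, Φ⟩ = π^d conj⟨f, χ⟩ ⟨f, φ⟩
(`Ultradistribution.wigner_crossWigner`). Since `Wig f` is a function W, Fubini turns ∫ W Φ into ∫ u
φ, where u superposes time-frequency shifts of one window with density W (`wignerSynthesis`,
`integral_mul_crossWigner`). Hence f is a constant multiple of u.

It remains to see that u is in 𝒮_ω. Hölder against e^{-mω}, integrable for some m by (γ), turns the
mixed-norm hypothesis into integrability of e^{l(ω(x)+ω(ξ))} W for every l
(`integrable_exp_mul_norm_of_memMixedLp`), and p, q disappear. Shifting the window in time costs a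
factor e^{kω(x)} in the decay of u, shifting it in frequency costs e^{kω(ξ)} in the decay of û, and
W absorbs both (`memBeurling_wignerSynthesis`).

Derivatives need no separate estimate: decay of u and û makes all derivatives of both bounded, and
interpolating between decay and boundedness (`RapidlyDecreasing.fderiv`) makes them decay
(`memBeurling_of_rapidlyDecreasing`). The same criterion puts Φ in 𝒮_ω, because its Fourier
transform is again an ambiguity function (`fourierHat_crossWigner`). -/

theorem continuous_comp_norm (hω : IsNonquasianalyticWeight ω) :
    Continuous (fun x : E => ω ‖x‖) :=
  hω.continuousOn.comp_continuous continuous_norm fun x => norm_nonneg x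

theorem exists_two_pow_mul_le (hω : IsNonquasianalyticWeight ω) (n : ℕ) :
    ∃ L K : ℝ, 1 ≤ L ∧ 0 ≤ K ∧ ∀ t, 0 ≤ t → ω (2 ^ n * t) ≤ L * ω t + K := by
  obtain ⟨A, hA, h⟩ := hω.alpha
  induction n with
  | zero => exact ⟨1, 0, le_rfl, le_rfl, fun t _ => by simp⟩
  | succ n ih =>
    obtain ⟨L, K, hL, hK, ih⟩ := ih
    refine ⟨A * L, A * K + A, by nlinarith, by positivity, fun t ht => ?_⟩
    have h1 := h (2 ^ n * t) (by positivity)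
    have h2 := mul_le_mul_of_nonneg_left (ih t ht) (by linarith : 0 ≤ A)
    rw [pow_succ', mul_assoc]
    linarith

/-- Condition (α) is iterated until 2^n > 2c: for s ≥ 1 one has r ≤ 2^n s, and for s ≤ 1 the
constant ω(2^n) suffices. The loss L is harmless wherever decay holds at every rate. -/
theorem exists_le_of_le_mul (hω : IsNonquasianalyticWeight ω) (c : ℝ) :
    ∃ L K : ℝ, 1 ≤ L ∧ 0 ≤ K ∧
      ∀ r s, 0 ≤ r → 0 ≤ s → r ≤ c * (s + 1) → ω r ≤ L * ω s + K := by
  obtain ⟨n, hn⟩ := pow_unbounded_of_one_lt (2 * c) one_lt_two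
  obtain ⟨L, K, hL, hK, h⟩ := hω.exists_two_pow_mul_le n
  have h2 : (0 : ℝ) < 2 ^ n := by positivity
  have h4 := hω.nonneg (2 ^ n) h2.le
  refine ⟨L, K + ω (2 ^ n), hL, by positivity, fun r s hr hs hrs => ?_⟩
  have hs0 := hω.nonneg s hs
  rcases le_total 1 s with h1 | h1
  · have a1 : ω r ≤ ω (2 ^ n * s) :=
      hω.monotoneOn hr (by simp only [mem_Ici]; positivity) (by nlinarith)
    linarith [h s hs]
  · have a1 : ω r ≤ ω (2 ^ n) := hω.monotoneOn hr h2.le (by nlinarith)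
    have : 0 ≤ L * ω s := by positivity
    linarith

variable [NormedSpace ℝ E] [FiniteDimensional ℝ E] [MeasurableSpace E] [BorelSpace E]

theorem exists_integrable_norm_pow_mul_exp (hω : IsNonquasianalyticWeight ω) (n : ℕ)
    (μ : Measure E) [μ.IsAddHaarMeasure] :
    ∃ m : ℝ, 0 < m ∧ Integrable (fun x : E => ‖x‖ ^ n * Real.exp (-(m * ω ‖x‖))) μ := by
  obtain ⟨a, b, hb, h⟩ := hω.gamma
  set N : ℕ := Module.finrank ℝ E + 1
  have hm : 0 < ((N + n : ℕ) : ℝ) / b := by positivity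
  -- By (γ) this rate gives e^{-mω} ≤ C (1 + ‖x‖)^{-(N+n)}: the power n absorbs ‖x‖^n, and N = dim +
  -- 1 is left for integrability.
  refine ⟨((N + n : ℕ) : ℝ) / b, hm, ?_⟩
  have hint : Integrable (fun x : E => (1 + ‖x‖) ^ (-(N : ℝ))) μ :=
    integrable_one_add_norm (by simp [N])
  refine (hint.const_mul (Real.exp (-(((N + n : ℕ) : ℝ) / b * a)))).mono' ?_ ?_
  · have := hω.continuous_comp_norm (E := E)
    exact ((continuous_norm.pow n).mul
      (Real.continuous_exp.comp (this.const_mul _).neg)).aestronglyMeasurable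
  · refine Filter.Eventually.of_forall fun x => ?_
    have hx : 0 < 1 + ‖x‖ := by positivity
    rw [Real.norm_of_nonneg (by positivity)]
    have e1 : Real.exp (-(((N + n : ℕ) : ℝ) / b * ω ‖x‖)) ≤
        Real.exp (-(((N + n : ℕ) : ℝ) / b * a)) * ((1 + ‖x‖) ^ (N + n))⁻¹ := by
      have : ((1 + ‖x‖) ^ (N + n))⁻¹ = Real.exp (-((N + n : ℕ) * Real.log (1 + ‖x‖))) := by
        rw [Real.exp_neg, Real.exp_nat_mul, Real.exp_log hx]
      rw [this, ← Real.exp_add]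
      refine Real.exp_le_exp.2 ?_
      have := mul_le_mul_of_nonneg_left (h ‖x‖ (norm_nonneg x)) hm.le
      have e : ((N + n : ℕ) : ℝ) / b * (a + b * Real.log (1 + ‖x‖)) =
        ((N + n : ℕ) : ℝ) / b * a + (N + n : ℕ) * Real.log (1 + ‖x‖) := by
        field_simp
      linarith
    calc ‖x‖ ^ n * Real.exp (-(((N + n : ℕ) : ℝ) / b * ω ‖x‖))
        ≤ (1 + ‖x‖) ^ n * (Real.exp (-(((N + n : ℕ) : ℝ) / b * a)) *
            ((1 + ‖x‖) ^ (N + n))⁻¹) := by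
          gcongr
          linarith
      _ = Real.exp (-(((N + n : ℕ) : ℝ) / b * a)) * (1 + ‖x‖) ^ (-(N : ℝ)) := by
          rw [Real.rpow_neg hx.le, Real.rpow_natCast, pow_add]
          field_simp

theorem exists_integrable_exp (hω : IsNonquasianalyticWeight ω) (μ : Measure E)
    [μ.IsAddHaarMeasure] :
    ∃ m : ℝ, 0 < m ∧ Integrable (fun x : E => Real.exp (-(m * ω ‖x‖))) μ := by
  simpa using hω.exists_integrable_norm_pow_mul_exp 0 μ

end IsNonquasianalyticWeight

/-- Functions with `‖g x‖ = O(e^{-l ω(|x|)})` for every `l > 0`. -/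
def RapidlyDecreasing {E F : Type*} [NormedAddCommGroup E] [NormedAddCommGroup F] (ω : ℝ → ℝ)
    (g : E → F) : Prop :=
  ∀ l : ℝ, 0 < l → ∃ C : ℝ, ∀ x, ‖g x‖ ≤ C * Real.exp (-(l * ω ‖x‖))

/-! ### Decay at every rate: comparison, products, integrability, derivatives -/

namespace RapidlyDecreasing

variable {ω : ℝ → ℝ} {E F : Type*} [NormedAddCommGroup E] [NormedAddCommGroup F] {g : E → F}

theorem exists_nonneg (hg : RapidlyDecreasing ω g) {l : ℝ} (hl : 0 < l) :
    ∃ C : ℝ, 0 ≤ C ∧ ∀ x, ‖g x‖ ≤ C * Real.exp (-(l * ω ‖x‖)) := by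
  obtain ⟨C, hC⟩ := hg l hl
  refine ⟨max C 0, le_max_right _ _, fun x => (hC x).trans ?_⟩
  gcongr
  exact le_max_left _ _

theorem exists_bound (hω : IsNonquasianalyticWeight ω) (hg : RapidlyDecreasing ω g) :
    ∃ C : ℝ, 0 ≤ C ∧ ∀ x, ‖g x‖ ≤ C := by
  obtain ⟨C, hC0, hC⟩ := hg.exists_nonneg one_pos
  refine ⟨C, hC0, fun x => (hC x).trans (mul_le_of_le_one_right hC0 ?_)⟩
  have := hω.nonneg ‖x‖ (norm_nonneg x)
  exact Real.exp_le_one_iff.2 (by linarith)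

theorem exists_bound_of_le (hω : IsNonquasianalyticWeight ω) (hg : RapidlyDecreasing ω g)
    {l : ℝ} (hl : 0 < l) (c : ℝ) :
    ∃ C : ℝ, 0 ≤ C ∧ ∀ (r : ℝ) (x : E), 0 ≤ r → r ≤ c * (‖x‖ + 1) →
      ‖g x‖ ≤ C * Real.exp (-(l * ω r)) := by
  obtain ⟨L, K, hL, hK, h⟩ := hω.exists_le_of_le_mul c
  obtain ⟨C, hC0, hC⟩ := hg.exists_nonneg (l := l * L) (by positivity)
  refine ⟨C * Real.exp (l * K), by positivity, fun r x hr hrx => (hC x).trans ?_⟩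
  rw [mul_assoc C, ← Real.exp_add]
  gcongr
  have := mul_le_mul_of_nonneg_left (h r ‖x‖ hr (norm_nonneg x) hrx) hl.le
  linarith

theorem comp_norm_eq (hg : RapidlyDecreasing ω g) {G : Type*} [NormedAddCommGroup G] {g' : E → G}
    (φ : E → E) (hφ : ∀ x, ‖φ x‖ = ‖x‖) (h : ∀ x, ‖g' x‖ = ‖g (φ x)‖) :
    RapidlyDecreasing ω g' := by
  intro l hl
  obtain ⟨C, hC⟩ := hg l hl
  refine ⟨C, fun x => ?_⟩
  rw [h, ← hφ x]
  exact hC _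

/-- The larger of ‖x‖ and ‖y‖ controls r, but which one it is may vary; both factors therefore decay
at rate l * L. The extra rate m in x is kept for a later integration. -/
theorem exists_norm_mul_norm_le (hω : IsNonquasianalyticWeight ω) {E' F' : Type*}
    [NormedAddCommGroup E'] [NormedAddCommGroup F'] {g' : E' → F'} (hg : RapidlyDecreasing ω g)
    (hg' : RapidlyDecreasing ω g') {l m : ℝ} (hl : 0 < l) (hm : 0 < m) (c : ℝ) :
    ∃ C : ℝ, 0 ≤ C ∧ ∀ (r : ℝ) (x : E) (y : E'), 0 ≤ r → r ≤ c * (max ‖x‖ ‖y‖ + 1) →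
      ‖g x‖ * ‖g' y‖ ≤ C * Real.exp (-(l * ω r)) * Real.exp (-(m * ω ‖x‖)) := by
  obtain ⟨L, K, hL, hK, h⟩ := hω.exists_le_of_le_mul c
  obtain ⟨C, hC0, hC⟩ := hg.exists_nonneg (l := l * L + m) (by positivity)
  obtain ⟨C', hC0', hC'⟩ := hg'.exists_nonneg (l := l * L) (by positivity)
  refine ⟨C * C' * Real.exp (l * K), by positivity, fun r x y hr hrx => ?_⟩
  refine (mul_le_mul (hC x) (hC' y) (norm_nonneg _) (by positivity)).trans ?_
  rw [mul_mul_mul_comm, ← Real.exp_add]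
  have e : C * C' * Real.exp (l * K) * Real.exp (-(l * ω r)) * Real.exp (-(m * ω ‖x‖)) =
      C * C' * Real.exp (l * K + -(l * ω r) + -(m * ω ‖x‖)) := by
    rw [Real.exp_add, Real.exp_add]
    ring
  rw [e]
  refine mul_le_mul_of_nonneg_left (Real.exp_le_exp.2 ?_) (by positivity)
  have h1 := h r (max ‖x‖ ‖y‖) hr (by positivity) hrx
  have hx := hω.nonneg ‖x‖ (norm_nonneg x)
  have hy := hω.nonneg ‖y‖ (norm_nonneg y)
  have h2 : ω (max ‖x‖ ‖y‖) ≤ ω ‖x‖ + ω ‖y‖ := by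
    rcases max_choice ‖x‖ ‖y‖ with e | e <;> rw [e] <;> linarith
  have h3 := mul_le_mul_of_nonneg_left (h1.trans (add_le_add_left
    (mul_le_mul_of_nonneg_left h2 (by linarith : 0 ≤ L)) K)) hl.le
  nlinarith

section Integrable

variable [NormedSpace ℝ E] [FiniteDimensional ℝ E] [MeasurableSpace E] [BorelSpace E]
  {μ : Measure E} [μ.IsAddHaarMeasure]

theorem integrable_norm_pow_mul (hω : IsNonquasianalyticWeight ω) (hg : RapidlyDecreasing ω g)
    (hm : AEStronglyMeasurable g μ) (n : ℕ) : Integrable (fun x => ‖x‖ ^ n * ‖g x‖) μ := by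
  obtain ⟨m, hm0, hint⟩ := hω.exists_integrable_norm_pow_mul_exp n μ
  obtain ⟨C, -, hC⟩ := hg.exists_nonneg hm0
  refine (hint.const_mul C).mono'
    ((Continuous.aestronglyMeasurable (by fun_prop)).mul hm.norm) ?_
  refine Filter.Eventually.of_forall fun x => ?_
  rw [Real.norm_of_nonneg (by positivity), mul_left_comm]
  gcongr
  exact hC x

theorem integrable (hω : IsNonquasianalyticWeight ω) (hg : RapidlyDecreasing ω g)
    (hm : AEStronglyMeasurable g μ) : Integrable g μ := by
  have := hg.integrable_norm_pow_mul hω hm 0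
  simp only [pow_zero, one_mul] at this
  exact (integrable_norm_iff hm).1 this

end Integrable

/-- A rapidly decreasing function with Lipschitz derivative has a rapidly decreasing derivative. -/
theorem fderiv [NormedSpace ℝ E] [NormedSpace ℝ F] (hω : IsNonquasianalyticWeight ω)
    (hg : RapidlyDecreasing ω g) (hd : Differentiable ℝ g) {M : ℝ}
    (hM : ∀ x y, ‖_root_.fderiv ℝ g x - _root_.fderiv ℝ g y‖ ≤ M * ‖x - y‖) :
    RapidlyDecreasing ω (_root_.fderiv ℝ g) := by
  intro l hl
  -- Decay of g at the doubled rate matches the first-order Taylor error for the increment h =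
  -- e^{-lω(‖x‖)}: both are O(h²), and dividing by h leaves O(h). As h ≤ 1, ‖x‖ ≤ ‖x + h • v‖ + 1,
  -- so the factor 2 suffices.
  obtain ⟨C, hC0, hC⟩ := hg.exists_bound_of_le hω (l := l + l) (by positivity) 2
  refine ⟨2 * C + |M|, fun x => ?_⟩
  set h : ℝ := Real.exp (-(l * ω ‖x‖)) with hh
  have h0 : 0 < h := Real.exp_pos _
  have h1 : h ≤ 1 := Real.exp_le_one_iff.2 (by
    have := mul_nonneg hl.le (hω.nonneg ‖x‖ (norm_nonneg x))
    linarith)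
  have hsq : Real.exp (-((l + l) * ω ‖x‖)) = h * h := by
    rw [hh, ← Real.exp_add]
    ring_nf
  refine ContinuousLinearMap.opNorm_le_of_unit_norm (by positivity) fun v hv => ?_
  have hn : ‖h • v‖ = h := by rw [norm_smul, hv, mul_one, Real.norm_of_nonneg h0.le]
  have key : ‖g (x + h • v) - g x - _root_.fderiv ℝ g x (h • v)‖ ≤ |M| * h * h := by
    have := (convex_closedBall x h).norm_image_sub_le_of_norm_hasFDerivWithin_le'
      (f := g) (f' := _root_.fderiv ℝ g) (φ := _root_.fderiv ℝ g x) (C := |M| * h) (x := x)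
      (y := x + h • v) (fun y _ => (hd y).hasFDerivAt.hasFDerivWithinAt) (fun y hy => ?_)
      (Metric.mem_closedBall_self h0.le) (by simp [hn])
    · simpa [hn] using this
    · refine (hM y x).trans (mul_le_mul (le_abs_self M) ?_ (norm_nonneg _) (abs_nonneg M))
      simpa [dist_eq_norm] using hy
  have b1 : ‖g (x + h • v)‖ ≤ C * (h * h) := by
    rw [← hsq]
    refine hC _ _ (norm_nonneg x) ?_
    have : ‖x‖ ≤ ‖x + h • v‖ + ‖h • v‖ := by simpa using norm_sub_le (x + h • v) (h • v)
    have := norm_nonneg (x + h • v)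
    linarith
  have b2 : ‖g x‖ ≤ C * (h * h) := by
    rw [← hsq]
    refine hC _ _ (norm_nonneg x) ?_
    have := norm_nonneg x
    linarith
  have b3 : h * ‖_root_.fderiv ℝ g x v‖ ≤ h * ((2 * C + |M|) * h) := by
    have e : h * ‖_root_.fderiv ℝ g x v‖ = ‖_root_.fderiv ℝ g x (h • v)‖ := by
      rw [map_smul, norm_smul, Real.norm_of_nonneg h0.le]
    have t1 := norm_sub_le (g (x + h • v) - g x)
      (g (x + h • v) - g x - _root_.fderiv ℝ g x (h • v))
    have t2 := norm_sub_le (g (x + h • v)) (g x)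
    rw [sub_sub_cancel] at t1
    nlinarith
  exact le_of_mul_le_mul_left b3 h0

end RapidlyDecreasing

/-- A Landau-type interpolation, one order at a time: a bound on the derivative of order n + 2 makes
that of order n + 1 Lipschitz, so decay passes from order n to order n + 1. -/
theorem RapidlyDecreasing.iteratedFDeriv {ω : ℝ → ℝ} {E F : Type*} [NormedAddCommGroup E]
    [NormedAddCommGroup F] [NormedSpace ℝ E] [NormedSpace ℝ F] {g : E → F}
    (hω : IsNonquasianalyticWeight ω) (hg : RapidlyDecreasing ω g)
    (hd : ContDiff ℝ (⊤ : ℕ∞) g) (hb : ∀ n : ℕ, ∃ M, ∀ x, ‖iteratedFDeriv ℝ n g x‖ ≤ M) (n : ℕ) :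
    RapidlyDecreasing ω (iteratedFDeriv ℝ n g) := by
  induction n with
  | zero => exact hg.comp_norm_eq id (fun _ => rfl) fun x => norm_iteratedFDeriv_zero
  | succ n ih =>
    obtain ⟨M, hM⟩ := hb (n + 2)
    have hN : ∀ k : ℕ, ((k : ℕ) : WithTop ℕ∞) < ((⊤ : ℕ∞) : WithTop ℕ∞) := fun k => by
      exact_mod_cast WithTop.coe_lt_top k
    have hdn : ∀ k : ℕ, Differentiable ℝ (_root_.iteratedFDeriv ℝ k g) := fun k =>
      hd.differentiable_iteratedFDeriv (hN k)
    refine (ih.fderiv hω (hdn n) (M := M) fun x y => ?_).comp_norm_eq id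
      (fun _ => rfl) fun x => norm_fderiv_iteratedFDeriv.symm
    -- The derivative of the n-th derivative and the (n+1)-st derivative differ by currying, a
    -- linear isometry.
    have e : ‖_root_.fderiv ℝ (_root_.iteratedFDeriv ℝ n g) x -
        _root_.fderiv ℝ (_root_.iteratedFDeriv ℝ n g) y‖ =
        ‖_root_.iteratedFDeriv ℝ (n + 1) g x - _root_.iteratedFDeriv ℝ (n + 1) g y‖ := by
      have h := (continuousMultilinearCurryLeftEquiv ℝ (fun _ : Fin (n + 1) => E)
        F).symm.isometry.dist_eq (_root_.fderiv ℝ (_root_.iteratedFDeriv ℝ n g) x)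
          (_root_.fderiv ℝ (_root_.iteratedFDeriv ℝ n g) y)
      exact ((dist_eq_norm _ _).symm.trans (h.symm.trans (dist_eq_norm
        (E := ContinuousMultilinearMap ℝ (fun _ : Fin (n + 1) => E) F) _ _)))
    rw [e]
    refine convex_univ.norm_image_sub_le_of_norm_fderiv_le (𝕜 := ℝ) (fun z _ => hdn (n + 1) z)
      (fun z _ => ?_) (mem_univ y) (mem_univ x)
    rw [norm_fderiv_iteratedFDeriv]
    exact hM z

/-! ### The Fourier transform and the class `𝒮_ω` -/

section WeightedDeriv

variable {E : Type*} [NormedAddCommGroup E] [InnerProductSpace ℝ E] {ω : ℝ → ℝ} {u : E → ℂ}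

theorem RapidlyDecreasing.bddAbove_weightedDeriv (hω : IsNonquasianalyticWeight ω)
    (hu : RapidlyDecreasing ω u) (hd : ContDiff ℝ (⊤ : ℕ∞) u)
    (hb : ∀ n : ℕ, ∃ M, ∀ x, ‖_root_.iteratedFDeriv ℝ n u x‖ ≤ M) (l : ℝ) (hl : 0 < l) (n : ℕ) :
    BddAbove (range (weightedDeriv ω l n u)) := by
  obtain ⟨C, hC⟩ := hu.iteratedFDeriv hω hd hb n l hl
  refine ⟨C, ?_⟩
  rintro _ ⟨x, rfl⟩
  have := mul_le_mul_of_nonneg_left (hC x) (Real.exp_pos (l * ω ‖x‖)).le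
  rwa [mul_left_comm, ← Real.exp_add, add_neg_cancel, Real.exp_zero, mul_one] at this

theorem rapidlyDecreasing_of_bddAbove_weightedDeriv
    (h : ∀ l : ℝ, 0 < l → BddAbove (range (weightedDeriv ω l 0 u))) : RapidlyDecreasing ω u := by
  intro l hl
  obtain ⟨C, hC⟩ := h l hl
  refine ⟨C, fun x => ?_⟩
  have h1 : Real.exp (l * ω ‖x‖) * ‖u x‖ ≤ C := by
    have := hC (mem_range_self x)
    rwa [weightedDeriv, norm_iteratedFDeriv_zero] at this
  rw [Real.exp_neg, ← div_eq_mul_inv, le_div_iff₀ (Real.exp_pos _), mul_comm]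
  exact h1

end WeightedDeriv

/-! ### The Fourier transform, its inversion, and a membership criterion -/

section Fourier

variable {E : Type*} [NormedAddCommGroup E] [InnerProductSpace ℝ E] [FiniteDimensional ℝ E]
  [MeasurableSpace E] [BorelSpace E] {ω : ℝ → ℝ}

theorem norm_exp_neg_I_mul_ofReal (t : ℝ) : ‖Complex.exp (-(Complex.I * (t : ℂ)))‖ = 1 := by
  simp [Complex.norm_exp]

theorem norm_exp_I_mul_ofReal (t : ℝ) : ‖Complex.exp (Complex.I * (t : ℂ))‖ = 1 := by
  simp [Complex.norm_exp]

theorem norm_fourierHat_le (u : E → ℂ) (ξ : E) : ‖fourierHat u ξ‖ ≤ ∫ x, ‖u x‖ := by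
  refine (norm_integral_le_integral_norm _).trans (le_of_eq ?_)
  simp only [norm_mul, norm_exp_neg_I_mul_ofReal, one_mul]

theorem fourierHat_eq_fourier (u : E → ℂ) (ξ : E) :
    fourierHat u ξ = FourierTransform.fourier u ((2 * Real.pi)⁻¹ • ξ) := by
  rw [Real.fourier_eq', fourierHat]
  refine integral_congr_ae (Filter.Eventually.of_forall fun x => ?_)
  simp only [smul_eq_mul, inner_smul_right]
  congr 2
  push_cast
  have : (Real.pi : ℂ) ≠ 0 := by exact_mod_cast Real.pi_ne_zero
  field_simp

/-- Putting (2π)⁻¹ into the bilinear form, rather than rescaling ξ, makes the smoothness and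
derivative formulas for `VectorFourier.fourierIntegral` apply directly. -/
theorem fourierHat_eq_vectorFourier (u : E → ℂ) :
    fourierHat u = VectorFourier.fourierIntegral Real.fourierChar volume
      (((2 * Real.pi)⁻¹ • innerSL ℝ : E →L[ℝ] E →L[ℝ] ℝ)).toLinearMap₁₂ u := by
  funext ξ
  rw [fourierHat, VectorFourier.fourierIntegral]
  refine integral_congr_ae (Filter.Eventually.of_forall fun x => ?_)
  have e : ((2 * Real.pi)⁻¹ • innerSL ℝ : E →L[ℝ] E →L[ℝ] ℝ).toLinearMap₁₂ x ξ =
    (2 * Real.pi)⁻¹ * inner ℝ x ξ := rfl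
  simp only [Circle.smul_def, smul_eq_mul, Real.fourierChar_apply, e]
  congr 2
  push_cast
  have : (Real.pi : ℂ) ≠ 0 := by exact_mod_cast Real.pi_ne_zero
  field_simp

/-- The Fourier inversion formula for `fourierHat`. -/
theorem integral_exp_mul_fourierHat {u : E → ℂ} (hc : Continuous u) (hu : Integrable u)
    (hu' : Integrable (fourierHat u)) (x : E) :
    ∫ ξ, Complex.exp (Complex.I * ((inner ℝ x ξ : ℝ) : ℂ)) * fourierHat u ξ =
      (2 * Real.pi : ℂ) ^ Module.finrank ℝ E * u x := by
  have hpi : (0 : ℝ) < 2 * Real.pi := by positivity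
  have e : ∀ ξ, FourierTransform.fourier u ξ = fourierHat u ((2 * Real.pi) • ξ) := fun ξ => by
    rw [fourierHat_eq_fourier, smul_smul, inv_mul_cancel₀ hpi.ne', one_smul]
  have hF : Integrable (FourierTransform.fourier u) := by
    rw [funext e]
    exact hu'.comp_smul hpi.ne'
  have inv := congrFun (hc.fourierInv_fourier_eq hu hF) x
  rw [Real.fourierInv_eq'] at inv
  have sc := Measure.integral_comp_smul (volume : Measure E)
    (fun ξ => Complex.exp (Complex.I * ((inner ℝ x ξ : ℝ) : ℂ)) * fourierHat u ξ) (2 * Real.pi)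
  have : (fun v : E => Complex.exp (((2 * Real.pi * inner ℝ v x : ℝ) : ℂ) * Complex.I) •
      FourierTransform.fourier u v) = fun ξ => Complex.exp (Complex.I *
        ((inner ℝ x ((2 * Real.pi) • ξ) : ℝ) : ℂ)) * fourierHat u ((2 * Real.pi) • ξ) := by
    funext ξ
    rw [e, smul_eq_mul, inner_smul_right, real_inner_comm, mul_comm Complex.I]
  rw [this, sc, abs_of_pos (by positivity)] at inv
  rw [← inv, Complex.real_smul]
  push_cast
  rw [mul_inv_cancel_left₀]
  exact pow_ne_zero _ (by exact_mod_cast hpi.ne')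

theorem continuous_fourierHat {u : E → ℂ} (hu : Integrable u) : Continuous (fourierHat u) := by
  refine continuous_of_dominated (bound := fun x => ‖u x‖)
    (fun ξ => (integrable_exp_mul hu ξ).aestronglyMeasurable)
    (fun ξ => Filter.Eventually.of_forall fun x => ?_) hu.norm
    (Filter.Eventually.of_forall fun x => ?_)
  · rw [norm_mul, norm_exp_neg_I_mul_ofReal, one_mul]
  · fun_prop

theorem contDiff_fourierHat (hω : IsNonquasianalyticWeight ω) {u : E → ℂ}
    (hu : RapidlyDecreasing ω u) (hm : AEStronglyMeasurable u volume) :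
    ContDiff ℝ (⊤ : ℕ∞) (fourierHat u) := by
  rw [fourierHat_eq_vectorFourier]
  exact VectorFourier.contDiff_fourierIntegral _ fun n _ => hu.integrable_norm_pow_mul hω hm n

theorem exists_norm_iteratedFDeriv_fourierHat_le (hω : IsNonquasianalyticWeight ω) {u : E → ℂ}
    (hu : RapidlyDecreasing ω u) (hm : AEStronglyMeasurable u volume) (n : ℕ) :
    ∃ M, ∀ ξ, ‖iteratedFDeriv ℝ n (fourierHat u) ξ‖ ≤ M := by
  rw [fourierHat_eq_vectorFourier]
  rw [VectorFourier.iteratedFDeriv_fourierIntegral (N := ⊤) _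
    (fun n _ => hu.integrable_norm_pow_mul hω hm n) hm le_top]
  exact ⟨_, fun ξ => VectorFourier.norm_fourierIntegral_le_integral_norm _ _ _ _ _⟩

/-- A continuous function belongs to `𝒮_ω` as soon as it and its Fourier transform are rapidly
decreasing. -/
theorem memBeurling_of_rapidlyDecreasing (hω : IsNonquasianalyticWeight ω) {u : E → ℂ}
    (hc : Continuous u) (hu : RapidlyDecreasing ω u) (hu' : RapidlyDecreasing ω (fourierHat u)) :
    MemBeurling ω u := by
  have hm : AEStronglyMeasurable u volume := hc.aestronglyMeasurable
  have hi : Integrable u := hu.integrable hω hm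
  have hc' : Continuous (fourierHat u) := continuous_fourierHat hi
  have hi' : Integrable (fourierHat u) := hu'.integrable hω hc'.aestronglyMeasurable
  have hd' := contDiff_fourierHat hω hu hm
  -- By inversion u is the Fourier transform of v, a reflected multiple of û. Decay of û thus gives
  -- smoothness and bounded derivatives of u, as decay of u does for û.
  set v : E → ℂ := fun ξ => ((2 * Real.pi : ℂ) ^ Module.finrank ℝ E)⁻¹ * fourierHat u (-ξ)
  have hpi : (2 * Real.pi : ℂ) ^ Module.finrank ℝ E ≠ 0 :=
    pow_ne_zero _ (by exact_mod_cast (by positivity : (2 * Real.pi : ℝ) ≠ 0))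
  have hv : RapidlyDecreasing ω v := by
    intro l hl
    obtain ⟨C, hC⟩ := hu' l hl
    refine ⟨‖((2 * Real.pi : ℂ) ^ Module.finrank ℝ E)⁻¹‖ * C, fun ξ => ?_⟩
    rw [norm_mul, mul_assoc]
    gcongr
    simpa using hC (-ξ)
  have hvc : Continuous v := by fun_prop
  have huv : u = fourierHat v := by
    funext x
    have := integral_exp_mul_fourierHat hc hi hi' x
    rw [← integral_neg_eq_self] at this
    rw [fourierHat]
    simp only [v, mul_left_comm _ ((2 * Real.pi : ℂ) ^ Module.finrank ℝ E)⁻¹]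
    rw [integral_const_mul, eq_inv_mul_iff_mul_eq₀ hpi, ← this]
    refine integral_congr_ae (Filter.Eventually.of_forall fun ξ => ?_)
    simp [real_inner_comm]
  have hd : ContDiff ℝ (⊤ : ℕ∞) u := by
    rw [huv]
    exact contDiff_fourierHat hω hv hvc.aestronglyMeasurable
  refine ⟨hi, hd, hd', hu.bddAbove_weightedDeriv hω hd fun n => ?_,
    hu'.bddAbove_weightedDeriv hω hd' fun n => exists_norm_iteratedFDeriv_fourierHat_le hω hu hm n⟩
  rw [huv]
  exact exists_norm_iteratedFDeriv_fourierHat_le hω hv hvc.aestronglyMeasurable n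

namespace MemBeurling

variable {u : E → ℂ}

theorem continuous (hu : MemBeurling ω u) : Continuous u := hu.contDiff.continuous

theorem continuous_hat (hu : MemBeurling ω u) : Continuous (fourierHat u) :=
  hu.contDiff_hat.continuous

theorem rapidlyDecreasing (hu : MemBeurling ω u) : RapidlyDecreasing ω u :=
  rapidlyDecreasing_of_bddAbove_weightedDeriv fun l hl => hu.bdd l hl 0

theorem rapidlyDecreasing_hat (hu : MemBeurling ω u) : RapidlyDecreasing ω (fourierHat u) :=
  rapidlyDecreasing_of_bddAbove_weightedDeriv fun l hl => hu.bdd_hat l hl 0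

theorem integrable_hat (hω : IsNonquasianalyticWeight ω) (hu : MemBeurling ω u) :
    Integrable (fourierHat u) :=
  hu.rapidlyDecreasing_hat.integrable hω hu.continuous_hat.aestronglyMeasurable

theorem comp_neg (hω : IsNonquasianalyticWeight ω) (hu : MemBeurling ω u) :
    MemBeurling ω (fun x => u (-x)) := by
  have hc := hu.continuous
  refine memBeurling_of_rapidlyDecreasing hω (by fun_prop)
    (hu.rapidlyDecreasing.comp_norm_eq (fun x => -x) norm_neg fun _ => rfl)
    (hu.rapidlyDecreasing_hat.comp_norm_eq (fun x => -x) norm_neg fun ξ => ?_)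
  rw [fourierHat, fourierHat, ← integral_neg_eq_self]
  simp

theorem conj_comp (hω : IsNonquasianalyticWeight ω) (hu : MemBeurling ω u) :
    MemBeurling ω (fun x => conj (u x)) := by
  have hc := hu.continuous
  refine memBeurling_of_rapidlyDecreasing hω (by fun_prop)
    (hu.rapidlyDecreasing.comp_norm_eq id (fun _ => rfl) fun _ => RCLike.norm_conj _)
    (hu.rapidlyDecreasing_hat.comp_norm_eq (fun x => -x) norm_neg fun ξ => ?_)
  rw [← RCLike.norm_conj (fourierHat u (-ξ)), fourierHat, fourierHat, ← integral_conj]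
  congr 2
  funext x
  simp [← Complex.exp_conj]

end MemBeurling

end Fourier

/-! ### The cross ambiguity function and the cross Wigner transform of test functions -/

theorem norm_withLp_le_two_mul_max {E : Type*} [NormedAddCommGroup E]
    (z : WithLp 2 (E × E)) : ‖z‖ ≤ 2 * max ‖z.fst‖ ‖z.snd‖ := by
  rw [WithLp.prod_norm_eq_of_L2]
  have h1 := le_max_left ‖z.fst‖ ‖z.snd‖
  have h2 := le_max_right ‖z.fst‖ ‖z.snd‖
  refine Real.sqrt_le_iff.2 ⟨by positivity, ?_⟩
  nlinarith [norm_nonneg z.fst, norm_nonneg z.snd]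

section Ambiguity

variable {E : Type*} [NormedAddCommGroup E] [InnerProductSpace ℝ E] [FiniteDimensional ℝ E]
  [MeasurableSpace E] [BorelSpace E] {ω : ℝ → ℝ}

/-- `∫ φ(t + x) θ(t - x) e^{-i⟨t, ξ⟩} dt`. -/
noncomputable def crossAmbiguity (φ θ : E → ℂ) (x ξ : E) : ℂ :=
  fourierHat (fun t => φ (t + x) * θ (t - x)) ξ

/-- The function `(x, ξ) ↦ ∫ φ(x + t) θ(t - x) e^{2i⟨t, ξ⟩} dt`. -/
noncomputable def crossWigner (φ θ : E → ℂ) (z : WithLp 2 (E × E)) : ℂ :=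
  crossAmbiguity φ θ z.fst ((-2 : ℝ) • z.snd)

variable {φ θ : E → ℂ}

theorem integrable_mul_translate (hω : IsNonquasianalyticWeight ω) (hφ : MemBeurling ω φ)
    (hθ : MemBeurling ω θ) (x : E) : Integrable (fun t => φ (t + x) * θ (t - x)) := by
  obtain ⟨C, -, hC⟩ := hθ.rapidlyDecreasing.exists_bound hω
  have := hθ.continuous
  exact (hφ.integrable.comp_add_right x).mul_bdd (c := C)
    (Continuous.aestronglyMeasurable (by fun_prop)) (Filter.Eventually.of_forall fun t => hC _)

/-- The substitution r = t + x frees φ from x. This supplies a dominating function independent of x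
and isolates φ for the later use of Fubini. -/
theorem crossAmbiguity_eq_integral (φ θ : E → ℂ) (x ξ : E) :
    crossAmbiguity φ θ x ξ = ∫ r, Complex.exp (-(Complex.I * ((inner ℝ (r - x) ξ : ℝ) : ℂ))) *
      (φ r * θ (r - (2 : ℝ) • x)) := by
  rw [crossAmbiguity, fourierHat, ← integral_sub_right_eq_self _ x]
  refine integral_congr_ae (Filter.Eventually.of_forall fun r => ?_)
  simp only [sub_add_cancel, sub_sub, two_smul]

theorem continuous_crossAmbiguity (hω : IsNonquasianalyticWeight ω) (hφ : MemBeurling ω φ)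
    (hθ : MemBeurling ω θ) : Continuous (fun z : E × E => crossAmbiguity φ θ z.1 z.2) := by
  obtain ⟨C, -, hC⟩ := hθ.rapidlyDecreasing.exists_bound hω
  have hφc := hφ.continuous
  have hθc := hθ.continuous
  simp only [crossAmbiguity_eq_integral]
  refine continuous_of_dominated (bound := fun r => ‖φ r‖ * C)
    (fun z => Continuous.aestronglyMeasurable (by fun_prop))
    (fun z => Filter.Eventually.of_forall fun r => ?_) (hφ.integrable.norm.mul_const C)
    (Filter.Eventually.of_forall fun r => by fun_prop)
  rw [norm_mul, norm_exp_neg_I_mul_ofReal, one_mul, norm_mul]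
  gcongr
  exact hC _

theorem exists_norm_crossAmbiguity_le_left (hω : IsNonquasianalyticWeight ω)
    (hφ : MemBeurling ω φ) (hθ : MemBeurling ω θ) {l : ℝ} (hl : 0 < l) (c : ℝ) :
    ∃ C : ℝ, 0 ≤ C ∧ ∀ (r : ℝ) (x ξ : E), 0 ≤ r → r ≤ c * (‖x‖ + 1) →
      ‖crossAmbiguity φ θ x ξ‖ ≤ C * Real.exp (-(l * ω r)) := by
  obtain ⟨m, hm, hint⟩ := hω.exists_integrable_exp (volume : Measure E)
  obtain ⟨C, hC0, hC⟩ := hφ.rapidlyDecreasing.exists_norm_mul_norm_le hω hθ.rapidlyDecreasing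
    hl hm |c|
  refine ⟨C * ∫ t : E, Real.exp (-(m * ω ‖t‖)), by positivity, fun r x ξ hr hrx => ?_⟩
  refine (norm_fourierHat_le _ _).trans ?_
  rw [mul_right_comm, ← integral_const_mul,
    ← integral_add_right_eq_self (fun t : E => C * Real.exp (-(l * ω r)) * _) x]
  refine integral_mono (integrable_mul_translate hω hφ hθ x).norm
    ((hint.comp_add_right x).const_mul _) fun t => ?_
  simp only [norm_mul]
  refine hC r (t + x) (t - x) hr ?_
  -- The two arguments differ by 2x, so one of them has norm at least ‖x‖.
  have h1 : ‖(t + x) - (t - x)‖ ≤ ‖t + x‖ + ‖t - x‖ := norm_sub_le _ _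
  have h2 : (t + x) - (t - x) = (2 : ℝ) • x := by rw [two_smul]; abel
  rw [h2, norm_smul, Real.norm_of_nonneg two_pos.le] at h1
  have h3 := le_max_left ‖t + x‖ ‖t - x‖
  have h4 := le_max_right ‖t + x‖ ‖t - x‖
  calc r ≤ c * (‖x‖ + 1) := hrx
    _ ≤ |c| * (‖x‖ + 1) := by gcongr; exact le_abs_self c
    _ ≤ _ := by gcongr; linarith

/-- Writing φ by Fourier inversion and integrating in t first turns the ambiguity function into a
modulated convolution of the two Fourier transforms. Decay in ξ then follows as decay in x does. -/
theorem norm_crossAmbiguity_le_integral_hat (hω : IsNonquasianalyticWeight ω)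
    (hφ : MemBeurling ω φ) (hθ : MemBeurling ω θ) (x ξ : E) :
    (2 * Real.pi) ^ Module.finrank ℝ E * ‖crossAmbiguity φ θ x ξ‖ ≤
      ∫ η, ‖fourierHat φ η‖ * ‖fourierHat θ (ξ - η)‖ := by
  have hφc := hφ.continuous
  have hθc := hθ.continuous
  have hφc' := hφ.continuous_hat
  have hφi' := hφ.integrable_hat hω
  set G : E → E → ℂ := fun t η => Complex.exp (-(Complex.I * ((inner ℝ t ξ : ℝ) : ℂ))) *
    (Complex.exp (Complex.I * ((inner ℝ (t + x) η : ℝ) : ℂ)) * fourierHat φ η * θ (t - x)) with hG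
  have hGi : Integrable (Function.uncurry G) (volume.prod volume) := by
    refine ((hθ.integrable.comp_sub_right x).norm.mul_prod hφi'.norm).mono'
      (Continuous.aestronglyMeasurable (by fun_prop)) (Filter.Eventually.of_forall fun p => ?_)
    simp only [Function.uncurry, hG, norm_mul, norm_exp_neg_I_mul_ofReal, norm_exp_I_mul_ofReal,
      one_mul]
    rw [mul_comm]
  have e1 : (2 * Real.pi : ℂ) ^ Module.finrank ℝ E * crossAmbiguity φ θ x ξ =
      ∫ t, ∫ η, G t η := by
    rw [crossAmbiguity, fourierHat, ← integral_const_mul]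
    refine integral_congr_ae (Filter.Eventually.of_forall fun t => ?_)
    simp only [hG]
    rw [integral_const_mul, integral_mul_const,
      integral_exp_mul_fourierHat hφc hφ.integrable hφi']
    ring
  have e2 : ∀ η, ∫ t, G t η = fourierHat φ η * Complex.exp (Complex.I *
      ((inner ℝ x ((2 : ℝ) • η - ξ) : ℝ) : ℂ)) * fourierHat θ (ξ - η) := by
    intro η
    rw [fourierHat.eq_1 θ, ← integral_const_mul, ← integral_add_right_eq_self _ x]
    refine integral_congr_ae (Filter.Eventually.of_forall fun t => ?_)
    simp only [hG, add_sub_cancel_right]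
    have : Complex.exp (-(Complex.I * ((inner ℝ (t + x) ξ : ℝ) : ℂ))) *
        Complex.exp (Complex.I * ((inner ℝ (t + x + x) η : ℝ) : ℂ)) =
        Complex.exp (Complex.I * ((inner ℝ x ((2 : ℝ) • η - ξ) : ℝ) : ℂ)) *
        Complex.exp (-(Complex.I * ((inner ℝ t (ξ - η) : ℝ) : ℂ))) := by
      rw [← Complex.exp_add, ← Complex.exp_add]
      congr 1
      simp only [inner_add_left, inner_sub_right, inner_smul_right]
      push_cast
      ring
    linear_combination (fourierHat φ η * θ t) * this
  have e3 : (2 * Real.pi) ^ Module.finrank ℝ E * ‖crossAmbiguity φ θ x ξ‖ =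
      ‖(2 * Real.pi : ℂ) ^ Module.finrank ℝ E * crossAmbiguity φ θ x ξ‖ := by
    rw [norm_mul, norm_pow, norm_mul, Complex.norm_real, Real.norm_of_nonneg Real.pi_pos.le]
    simp
  rw [e3, e1, integral_integral_swap hGi]
  refine (norm_integral_le_integral_norm _).trans (le_of_eq ?_)
  refine integral_congr_ae (Filter.Eventually.of_forall fun η => ?_)
  simp only [e2, norm_mul, norm_exp_I_mul_ofReal, mul_one]

theorem exists_norm_crossAmbiguity_le_right (hω : IsNonquasianalyticWeight ω)
    (hφ : MemBeurling ω φ) (hθ : MemBeurling ω θ) {l : ℝ} (hl : 0 < l) (c : ℝ) :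
    ∃ C : ℝ, 0 ≤ C ∧ ∀ (r : ℝ) (x ξ : E), 0 ≤ r → r ≤ c * (‖ξ‖ + 1) →
      ‖crossAmbiguity φ θ x ξ‖ ≤ C * Real.exp (-(l * ω r)) := by
  obtain ⟨m, hm, hint⟩ := hω.exists_integrable_exp (volume : Measure E)
  obtain ⟨C, hC0, hC⟩ := hφ.rapidlyDecreasing_hat.exists_norm_mul_norm_le hω
    hθ.rapidlyDecreasing_hat hl hm (2 * |c|)
  have hpi : 0 < (2 * Real.pi) ^ Module.finrank ℝ E := by positivity
  refine ⟨((2 * Real.pi) ^ Module.finrank ℝ E)⁻¹ * (C * ∫ t : E, Real.exp (-(m * ω ‖t‖))),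
    by positivity, fun r x ξ hr hrx => ?_⟩
  rw [mul_assoc, ← div_eq_inv_mul, le_div_iff₀ hpi, mul_comm]
  refine (norm_crossAmbiguity_le_integral_hat hω hφ hθ x ξ).trans ?_
  rw [mul_right_comm, ← integral_const_mul]
  refine integral_mono_of_nonneg (Filter.Eventually.of_forall fun η => by positivity)
    (hint.const_mul _) (Filter.Eventually.of_forall fun η => ?_)
  refine hC r η (ξ - η) hr ?_
  -- One of the two frequencies has norm at least ‖ξ‖ / 2, whence the constant 2 * |c| above.
  have h1 : ‖ξ‖ ≤ ‖η‖ + ‖ξ - η‖ := by simpa using norm_add_le η (ξ - η)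
  have h3 := le_max_left ‖η‖ ‖ξ - η‖
  have h4 := le_max_right ‖η‖ ‖ξ - η‖
  calc r ≤ c * (‖ξ‖ + 1) := hrx
    _ ≤ |c| * (‖ξ‖ + 1) := by gcongr; exact le_abs_self c
    _ ≤ |c| * (2 * (max ‖η‖ ‖ξ - η‖ + 1)) := by gcongr; linarith
    _ = _ := by ring

theorem exists_norm_crossAmbiguity_le (hω : IsNonquasianalyticWeight ω)
    (hφ : MemBeurling ω φ) (hθ : MemBeurling ω θ) {l : ℝ} (hl : 0 < l) (c : ℝ) :
    ∃ C : ℝ, 0 ≤ C ∧ ∀ (r : ℝ) (x ξ : E), 0 ≤ r → r ≤ c * (max ‖x‖ ‖ξ‖ + 1) →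
      ‖crossAmbiguity φ θ x ξ‖ ≤ C * Real.exp (-(l * ω r)) := by
  obtain ⟨A, hA0, hA⟩ := exists_norm_crossAmbiguity_le_left hω hφ hθ hl c
  obtain ⟨B, hB0, hB⟩ := exists_norm_crossAmbiguity_le_right hω hφ hθ hl c
  refine ⟨max A B, by positivity, fun r x ξ hr hrx => ?_⟩
  rcases max_choice ‖x‖ ‖ξ‖ with e | e <;> rw [e] at hrx
  · refine (hA r x ξ hr hrx).trans ?_
    gcongr
    exact le_max_left _ _
  · refine (hB r x ξ hr hrx).trans ?_
    gcongr
    exact le_max_right _ _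

/-- The partial Fourier inversion formula for the cross Wigner transform. -/
theorem integral_exp_mul_crossWigner (hω : IsNonquasianalyticWeight ω)
    (hφ : MemBeurling ω φ) (hθ : MemBeurling ω θ) (x w : E) :
    ∫ ξ, Complex.exp (-(Complex.I * ((inner ℝ ξ w : ℝ) : ℂ))) *
      crossWigner φ θ (WithLp.toLp 2 (x, ξ)) = (Real.pi : ℂ) ^ Module.finrank ℝ E *
        (φ ((2⁻¹ : ℝ) • w + x) * θ ((2⁻¹ : ℝ) • w - x)) := by
  have hφc := hφ.continuous
  have hθc := hθ.continuous
  have hint : Integrable (crossAmbiguity φ θ x) := by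
    refine RapidlyDecreasing.integrable hω (fun l hl => ?_) ((continuous_crossAmbiguity hω hφ
      hθ).comp (Continuous.prodMk_right x)).aestronglyMeasurable
    obtain ⟨C, -, hC⟩ := exists_norm_crossAmbiguity_le_right hω hφ hθ hl 1
    exact ⟨C, fun ξ => hC _ x ξ (norm_nonneg ξ) (by linarith)⟩
  have inv := integral_exp_mul_fourierHat (u := fun t => φ (t + x) * θ (t - x)) (by fun_prop)
    (integrable_mul_translate hω hφ hθ x) hint ((2⁻¹ : ℝ) • w)
  -- The frequency slot of `crossWigner` is -2ξ; rescaling costs 2^{-d} and turns the (2π)^d of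
  -- inversion into π^d.
  have sc := Measure.integral_comp_smul (volume : Measure E) (fun ζ => Complex.exp (Complex.I *
    ((inner ℝ ((2⁻¹ : ℝ) • w) ζ : ℝ) : ℂ)) * crossAmbiguity φ θ x ζ) (-2)
  have e : |((-2 : ℝ) ^ Module.finrank ℝ E)⁻¹| = (2 ^ Module.finrank ℝ E)⁻¹ := by
    simp [abs_inv, abs_pow]
  simp only [crossAmbiguity] at sc
  rw [e, inv, Complex.real_smul] at sc
  have e2 : ((((2 : ℝ) ^ Module.finrank ℝ E)⁻¹ : ℝ) : ℂ) * (2 * Real.pi : ℂ) ^ Module.finrank ℝ E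
      = (Real.pi : ℂ) ^ Module.finrank ℝ E := by
    push_cast
    rw [mul_pow, inv_mul_cancel_left₀ (by simp)]
  rw [← mul_assoc, e2] at sc
  rw [← sc]
  refine integral_congr_ae (Filter.Eventually.of_forall fun ξ => ?_)
  simp only [crossWigner, crossAmbiguity]
  congr 2
  rw [inner_smul_right, inner_smul_left, real_inner_comm]
  push_cast
  simp

/-- With x = (y + s)/2 and w = y - s, the points w/2 + x and w/2 - x are y and -s: the variables
separate. -/
theorem wignerTest_crossWigner (hω : IsNonquasianalyticWeight ω)
    (hφ : MemBeurling ω φ) (hθ : MemBeurling ω θ) (y s : E) :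
    wignerTest (crossWigner φ θ) y s =
      (Real.pi : ℂ) ^ Module.finrank ℝ E * (φ y * θ (-s)) := by
  rw [wignerTest, integral_exp_mul_crossWigner hω hφ hθ, ← smul_add, ← smul_sub]
  have e1 : (2⁻¹ : ℝ) • (y - s + (y + s)) = y := by
    rw [show y - s + (y + s) = (2 : ℝ) • y by rw [two_smul]; abel, smul_smul]; simp
  have e2 : (2⁻¹ : ℝ) • (y - s - (y + s)) = -s := by
    rw [show y - s - (y + s) = (2 : ℝ) • (-s) by rw [two_smul]; abel, smul_smul]; simp
  rw [e1, e2]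

theorem continuous_crossWigner (hω : IsNonquasianalyticWeight ω) (hφ : MemBeurling ω φ)
    (hθ : MemBeurling ω θ) : Continuous (crossWigner φ θ) := by
  have h := continuous_crossAmbiguity hω hφ hθ
  exact h.comp (f := fun z : WithLp 2 (E × E) => (z.fst, (-2 : ℝ) • z.snd)) (by fun_prop)

theorem rapidlyDecreasing_crossWigner (hω : IsNonquasianalyticWeight ω) (hφ : MemBeurling ω φ)
    (hθ : MemBeurling ω θ) : RapidlyDecreasing ω (crossWigner φ θ) := by
  intro l hl
  obtain ⟨C, -, hC⟩ := exists_norm_crossAmbiguity_le hω hφ hθ hl 2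
  refine ⟨C, fun z => hC _ _ _ (norm_nonneg z) ((norm_withLp_le_two_mul_max z).trans ?_)⟩
  rw [norm_smul]
  have h : ‖z.snd‖ ≤ ‖(-2 : ℝ)‖ * ‖z.snd‖ := by
    norm_num
    linarith [norm_nonneg z.snd]
  have := max_le_max_left ‖z.fst‖ h
  linarith

/-- Partial inversion removes the ξ-integral. What remains is a Fourier integral in x of φ(x + w/2)
θ(w/2 - x), an ambiguity function with θ reflected, so the bounds already proved apply. -/
theorem fourierHat_crossWigner (hω : IsNonquasianalyticWeight ω) (hφ : MemBeurling ω φ)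
    (hθ : MemBeurling ω θ) (ζ : WithLp 2 (E × E)) :
    fourierHat (crossWigner φ θ) ζ = (Real.pi : ℂ) ^ Module.finrank ℝ E *
      crossAmbiguity φ (fun t => θ (-t)) ((2⁻¹ : ℝ) • ζ.snd) ζ.fst := by
  have hc := continuous_crossWigner hω hφ hθ
  have hi : Integrable (crossWigner φ θ) :=
    (rapidlyDecreasing_crossWigner hω hφ hθ).integrable hω hc.aestronglyMeasurable
  have hi' := integrable_exp_mul hi ζ
  have hmp := (WithLp.volume_preserving_toLp E E)
  have hi2 : Integrable (fun p : E × E => Complex.exp (-(Complex.I *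
      ((inner ℝ (WithLp.toLp 2 p) ζ : ℝ) : ℂ))) * crossWigner φ θ (WithLp.toLp 2 p)) := (hmp.integrable_comp_emb (MeasurableEquiv.toLp 2 (E × E)).measurableEmbedding).2 hi'
  rw [fourierHat, ← hmp.integral_comp (MeasurableEquiv.toLp 2 (E × E)).measurableEmbedding]
  rw [Measure.volume_eq_prod] at hi2 ⊢
  rw [integral_prod _ hi2, crossAmbiguity, fourierHat, ← integral_const_mul]
  refine integral_congr_ae (Filter.Eventually.of_forall fun x => ?_)
  have e : ∀ ξ : E, Complex.exp (-(Complex.I *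
      ((inner ℝ (WithLp.toLp 2 (x, ξ)) ζ : ℝ) : ℂ))) =
      Complex.exp (-(Complex.I * ((inner ℝ x ζ.fst : ℝ) : ℂ))) *
      Complex.exp (-(Complex.I * ((inner ℝ ξ ζ.snd : ℝ) : ℂ))) := fun ξ => by
    rw [← Complex.exp_add, WithLp.prod_inner_apply]
    congr 1
    change -(Complex.I * ((inner ℝ x ζ.fst + inner ℝ ξ ζ.snd : ℝ) : ℂ)) = _
    push_cast
    ring
  simp only [e, mul_assoc]
  rw [integral_const_mul, integral_exp_mul_crossWigner hω hφ hθ, neg_sub, add_comm x]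
  ring

theorem memBeurling_crossWigner (hω : IsNonquasianalyticWeight ω) (hφ : MemBeurling ω φ)
    (hθ : MemBeurling ω θ) : MemBeurling ω (crossWigner φ θ) := by
  refine memBeurling_of_rapidlyDecreasing hω (continuous_crossWigner hω hφ hθ)
    (rapidlyDecreasing_crossWigner hω hφ hθ) fun l hl => ?_
  -- The 4 is one factor 2 for the product norm and one for the halved second component.
  obtain ⟨C, hC0, hC⟩ := exists_norm_crossAmbiguity_le hω hφ (hθ.comp_neg hω) hl 4
  refine ⟨‖(Real.pi : ℂ) ^ Module.finrank ℝ E‖ * C, fun ζ => ?_⟩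
  rw [fourierHat_crossWigner hω hφ hθ, norm_mul, mul_assoc]
  refine mul_le_mul_of_nonneg_left (hC _ _ _ (norm_nonneg ζ)
    ((norm_withLp_le_two_mul_max ζ).trans ?_)) (norm_nonneg _)
  have h1 := le_max_left ‖(2⁻¹ : ℝ) • ζ.snd‖ ‖ζ.fst‖
  have h2 := le_max_right ‖(2⁻¹ : ℝ) • ζ.snd‖ ‖ζ.fst‖
  have h3 : ‖(2⁻¹ : ℝ) • ζ.snd‖ = 2⁻¹ * ‖ζ.snd‖ := by
    rw [norm_smul]
    norm_num
  have : max ‖ζ.fst‖ ‖ζ.snd‖ ≤ 2 * max ‖(2⁻¹ : ℝ) • ζ.snd‖ ‖ζ.fst‖ := by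
    refine max_le ?_ ?_
    · linarith [norm_nonneg ζ.fst]
    · linarith
  linarith

end Ambiguity

/-! ### Integrability of functions in weighted mixed Lebesgue spaces -/

/-- Hölder against the constant 1 for ν, followed by monotonicity of the norm in the measure. -/
theorem lintegral_enorm_le_of_le_measure {α ε : Type*} {mα : MeasurableSpace α} {μ ν : Measure α}
    [TopologicalSpace ε] [ContinuousENorm ε] {f : α → ε} {p : ℝ≥0∞} (hν : ν ≤ μ) (hp : 1 ≤ p)
    (hf : AEStronglyMeasurable f ν) :
    ∫⁻ x, ‖f x‖ₑ ∂ν ≤ ν univ ^ (1 - 1 / p.toReal) * eLpNorm f p μ := by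
  have h := eLpNorm_le_eLpNorm_mul_rpow_measure_univ hp hf
  rw [eLpNorm_one_eq_lintegral_enorm, ENNReal.toReal_one, one_div_one, mul_comm] at h
  exact h.trans (mul_le_mul_right (eLpNorm_mono_measure f hν) _)

theorem measure_univ_rpow_ne_top {α : Type*} {mα : MeasurableSpace α} (ν : Measure α)
    [IsFiniteMeasure ν] {p : ℝ≥0∞} (hp : 1 ≤ p) : ν univ ^ (1 - 1 / p.toReal) ≠ ∞ := by
  refine ENNReal.rpow_ne_top_of_nonneg ?_ (measure_ne_top ν _)
  rcases eq_or_ne p ∞ with rfl | h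
  · simp
  · have : 1 ≤ p.toReal := by simpa using ENNReal.toReal_mono h hp
    rw [sub_nonneg]
    exact div_le_one_of_le₀ this (by linarith)

section MixedLp

variable {E : Type*} [NormedAddCommGroup E] [InnerProductSpace ℝ E] [FiniteDimensional ℝ E]
  [MeasurableSpace E] [BorelSpace E] {ω : ℝ → ℝ} {p q : ℝ≥0∞}

theorem MemMixedLp.lintegral_lintegral_lt_top {H : WithLp 2 (E × E) → ℂ} (hH : MemMixedLp p q H)
    (hp : 1 ≤ p) (hq : 1 ≤ q) {ν : Measure E} [IsFiniteMeasure ν] (hν : ν ≤ volume) :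
    ∫⁻ ξ, ∫⁻ x, ‖H (WithLp.toLp 2 (x, ξ))‖ₑ ∂ν ∂ν < ∞ := by
  have hac : ν ≪ volume := Measure.absolutelyContinuous_of_le hν
  have hm : AEStronglyMeasurable (fun z : E × E => H (WithLp.toLp 2 z)) (volume.prod volume) :=
    hH.1.comp_measurePreserving (WithLp.volume_preserving_toLp E E)
  have hs : AEStronglyMeasurable (fun z : E × E => H (WithLp.toLp 2 (z.2, z.1)))
      (volume.prod volume) := hm.prod_swap
  have hG : AEMeasurable (fun ξ => ∫⁻ x, ‖H (WithLp.toLp 2 (x, ξ))‖ₑ ∂ν) ν :=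
    (hs.mono_ac (hac.prod hac)).enorm.lintegral_prod_right'
  set c := (ν univ ^ (1 - 1 / p.toReal)).toNNReal with hc
  have hc' : (c : ℝ≥0∞) = ν univ ^ (1 - 1 / p.toReal) :=
    ENNReal.coe_toNNReal (measure_univ_rpow_ne_top ν hp)
  -- Hölder in x holds only for almost every ξ, since almost every slice is measurable; Hölder in ξ
  -- then follows.
  have h1 : ∀ᵐ ξ : E, ‖∫⁻ x, ‖H (WithLp.toLp 2 (x, ξ))‖ₑ ∂ν‖ₑ ≤
      c * ‖eLpNorm (fun x : E => H (WithLp.toLp 2 (x, ξ))) p volume‖ₑ := by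
    filter_upwards [hs.prodMk_left] with ξ hξ
    rw [hc']
    exact lintegral_enorm_le_of_le_measure hν hp (hξ.mono_ac hac)
  have h2 := lintegral_enorm_le_of_le_measure hν hq hG.aestronglyMeasurable
  refine h2.trans_lt (ENNReal.mul_lt_top (measure_univ_rpow_ne_top ν hq).lt_top ?_)
  refine (eLpNorm_le_nnreal_smul_eLpNorm_of_ae_le_mul' h1 q).trans_lt ?_
  exact ENNReal.mul_lt_top ENNReal.coe_lt_top hH.2

theorem MemMixedLp.integrable_exp_mul_norm (hω : IsNonquasianalyticWeight ω)
    {H : WithLp 2 (E × E) → ℂ} (hH : MemMixedLp p q H) (hp : 1 ≤ p) (hq : 1 ≤ q) {m : ℝ}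
    (hm : 0 < m) (hint : Integrable (fun x : E => Real.exp (-(m * ω ‖x‖)))) :
    Integrable (fun z => Real.exp (-(m * ω ‖z.fst‖)) * Real.exp (-(m * ω ‖z.snd‖)) * ‖H z‖) := by
  have hc : Continuous fun x : E => ω ‖x‖ := hω.continuous_comp_norm
  have hcm : Continuous fun x : E => Real.exp (-(m * ω ‖x‖)) :=
    Real.continuous_exp.comp (hc.const_mul m).neg
  have hmeas : AEStronglyMeasurable (fun z : WithLp 2 (E × E) =>
      Real.exp (-(m * ω ‖z.fst‖)) * Real.exp (-(m * ω ‖z.snd‖)) * ‖H z‖) volume :=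
    ((hcm.comp (by fun_prop : Continuous fun z : WithLp 2 (E × E) => z.fst)).mul
      (hcm.comp (by fun_prop : Continuous fun z : WithLp 2 (E × E) => z.snd))).aestronglyMeasurable.mul
        hH.1.norm
  have hmp := WithLp.volume_preserving_toLp E E
  have hmp' := (MeasurableEquiv.toLp 2 (E × E)).measurableEmbedding
  refine (hmp.integrable_comp_emb hmp').1 ?_
  have hmeas' := hmeas.comp_measurePreserving hmp
  refine ⟨hmeas', ?_⟩
  rw [hasFiniteIntegral_iff_enorm]
  rw [Measure.volume_eq_prod] at hmeas' ⊢
  rw [lintegral_prod_symm _ hmeas'.enorm]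
  set ρ : E → ℝ≥0∞ := fun x => ENNReal.ofReal (Real.exp (-(m * ω ‖x‖))) with hρ
  have hρm : Measurable ρ := hcm.measurable.ennreal_ofReal
  have hfin : IsFiniteMeasure (volume.withDensity ρ) := by
    refine isFiniteMeasure_withDensity ?_
    exact (hint.lintegral_lt_top).ne
  -- The weighted measure e^{-mω}dx lies below Lebesgue measure because ω ≥ 0, so Hölder for finite
  -- measures applies in each variable.
  have hle : (volume.withDensity ρ) ≤ (volume : Measure E) := by
    conv_rhs => rw [← withDensity_one (μ := (volume : Measure E))]
    refine withDensity_mono (Filter.Eventually.of_forall fun x => ?_)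
    have := mul_nonneg hm.le (hω.nonneg ‖x‖ (norm_nonneg x))
    exact ENNReal.ofReal_le_one.2 (Real.exp_le_one_iff.2 (by linarith))
  refine lt_of_eq_of_lt ?_ (hH.lintegral_lintegral_lt_top hp hq hle)
  rw [lintegral_withDensity_eq_lintegral_mul_non_measurable _ hρm
    (Filter.Eventually.of_forall fun x => ENNReal.ofReal_lt_top)]
  refine lintegral_congr fun ξ => ?_
  rw [Pi.mul_apply, lintegral_withDensity_eq_lintegral_mul_non_measurable _ hρm
    (Filter.Eventually.of_forall fun x => ENNReal.ofReal_lt_top),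
    ← lintegral_const_mul' _ _ ENNReal.ofReal_ne_top]
  refine lintegral_congr fun x => ?_
  simp only [Function.comp_apply, enorm_mul, Pi.mul_apply, hρ, enorm_norm,
    Real.enorm_eq_ofReal (Real.exp_pos _).le]
  change ENNReal.ofReal (Real.exp (-(m * ω ‖x‖))) * ENNReal.ofReal (Real.exp (-(m * ω ‖ξ‖))) *
    ‖H (WithLp.toLp 2 (x, ξ))‖ₑ = _
  ring

theorem integrable_exp_mul_norm_of_memMixedLp (hω : IsNonquasianalyticWeight ω) (hp : 1 ≤ p)
    (hq : 1 ≤ q) {W : WithLp 2 (E × E) → ℂ}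
    (hW : ∀ l m : ℝ, 0 < l → 0 < m → MemMixedLp p q (fun z =>
      ((Real.exp (l * ω ‖z.fst‖ + m * ω ‖z.snd‖) : ℝ) : ℂ) * W z)) {l : ℝ} (hl : 0 < l) :
    Integrable (fun z => Real.exp (l * (ω ‖z.fst‖ + ω ‖z.snd‖)) * ‖W z‖) := by
  obtain ⟨m, hm, hint⟩ := hω.exists_integrable_exp (volume : Measure E)
  -- The surplus m in both weights pays for the Hölder factors e^{-mω}.
  refine ((hW (l + m) (l + m) (by positivity) (by positivity)).integrable_exp_mul_norm hω hp hq hm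
    hint).congr (Filter.Eventually.of_forall fun z => ?_)
  simp only [norm_mul, Complex.norm_real, Real.norm_of_nonneg (Real.exp_pos _).le]
  rw [← mul_assoc, ← Real.exp_add, ← Real.exp_add]
  congr 2
  ring

theorem aestronglyMeasurable_of_memMixedLp (hω : IsNonquasianalyticWeight ω)
    {W : WithLp 2 (E × E) → ℂ}
    (hW : ∀ l m : ℝ, 0 < l → 0 < m → MemMixedLp p q (fun z =>
      ((Real.exp (l * ω ‖z.fst‖ + m * ω ‖z.snd‖) : ℝ) : ℂ) * W z)) :
    AEStronglyMeasurable W volume := by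
  have hc : Continuous fun x : E => ω ‖x‖ := hω.continuous_comp_norm
  have hc1 : Continuous fun z : WithLp 2 (E × E) => ω ‖z.fst‖ := hc.comp (by fun_prop)
  have hc2 : Continuous fun z : WithLp 2 (E × E) => ω ‖z.snd‖ := hc.comp (by fun_prop)
  have hm : AEStronglyMeasurable (fun z : WithLp 2 (E × E) =>
      ((Real.exp (-(1 * ω ‖z.fst‖ + 1 * ω ‖z.snd‖)) : ℝ) : ℂ)) volume :=
    (Complex.continuous_ofReal.comp (Real.continuous_exp.comp
      ((hc1.const_mul 1).add (hc2.const_mul 1)).neg)).aestronglyMeasurable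
  refine (hm.mul (hW 1 1 one_pos one_pos).1).congr (Filter.Eventually.of_forall fun z => ?_)
  simp only [Pi.mul_apply]
  rw [← mul_assoc, ← Complex.ofReal_mul, ← Real.exp_add, neg_add_cancel, Real.exp_zero,
    Complex.ofReal_one, one_mul]

end MixedLp

/-! ### Recovering the ultradistribution from its Wigner transform -/

/-- Since ‖r‖ ≤ ‖r - 2s‖ + 2‖s‖, ω(‖r‖) is at most a multiple of ω(‖r - 2s‖) + ω(‖s‖) plus a
constant. Translation thus preserves decay at the price of a weight in s. -/
theorem RapidlyDecreasing.exists_norm_sub_two_smul_le {ω : ℝ → ℝ} {E F : Type*}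
    [NormedAddCommGroup E] [NormedSpace ℝ E] [NormedAddCommGroup F]
    (hω : IsNonquasianalyticWeight ω) {g : E → F} (hg : RapidlyDecreasing ω g) {l : ℝ} (hl : 0 < l) :
    ∃ C k : ℝ, 0 ≤ C ∧ 0 < k ∧ ∀ r s : E,
      ‖g (r - (2 : ℝ) • s)‖ ≤ C * Real.exp (-(l * ω ‖r‖)) * Real.exp (k * ω ‖s‖) := by
  obtain ⟨L, K, hL, hK, h⟩ := hω.exists_le_of_le_mul 4
  obtain ⟨C, hC0, hC⟩ := hg.exists_nonneg (l := l * L) (by positivity)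
  refine ⟨C * Real.exp (l * K), l * L, by positivity, by positivity, fun r s => (hC _).trans ?_⟩
  have e : C * Real.exp (l * K) * Real.exp (-(l * ω ‖r‖)) * Real.exp (l * L * ω ‖s‖) =
      C * Real.exp (l * K + -(l * ω ‖r‖) + l * L * ω ‖s‖) := by
    rw [Real.exp_add, Real.exp_add]
    ring
  rw [e]
  refine mul_le_mul_of_nonneg_left (Real.exp_le_exp.2 ?_) hC0
  set t := r - (2 : ℝ) • s with ht
  have hr : ‖r‖ ≤ ‖t‖ + 2 * ‖s‖ := by
    have := norm_add_le t ((2 : ℝ) • s)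
    rwa [ht, sub_add_cancel, norm_smul, Real.norm_of_nonneg two_pos.le] at this
  have h3 := le_max_left ‖t‖ ‖s‖
  have h4 := le_max_right ‖t‖ ‖s‖
  have h0 : 0 ≤ max ‖t‖ ‖s‖ := (norm_nonneg t).trans h3
  have h1 := h ‖r‖ (max ‖t‖ ‖s‖) (norm_nonneg r) h0 (by linarith)
  have hx := hω.nonneg ‖t‖ (norm_nonneg t)
  have hy := hω.nonneg ‖s‖ (norm_nonneg s)
  have h2 : ω (max ‖t‖ ‖s‖) ≤ ω ‖t‖ + ω ‖s‖ := by
    rcases max_choice ‖t‖ ‖s‖ with e | e <;> rw [e] <;> linarith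
  have h5 := mul_le_mul_of_nonneg_left (h1.trans (add_le_add_left
    (mul_le_mul_of_nonneg_left h2 (by linarith : 0 ≤ L)) K)) hl.le
  nlinarith

/-! ### Synthesis of a function from its Wigner transform and a window -/

section Synthesis

variable {E : Type*} [NormedAddCommGroup E] [InnerProductSpace ℝ E] [FiniteDimensional ℝ E]
  [MeasurableSpace E] [BorelSpace E] {ω : ℝ → ℝ} {W : WithLp 2 (E × E) → ℂ} {φ θ : E → ℂ}

/-- The function `u` with `∫ W · crossWigner φ θ = ∫ φ u` for all test functions `φ`. -/
noncomputable def wignerSynthesis (W : WithLp 2 (E × E) → ℂ) (θ : E → ℂ) (r : E) : ℂ :=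
  ∫ z, W z * (Complex.exp (-(Complex.I * ((inner ℝ (r - z.fst) ((-2 : ℝ) • z.snd) : ℝ) : ℂ))) *
    θ (r - (2 : ℝ) • z.fst))

theorem integrable_of_integrable_exp_mul_norm (hω : IsNonquasianalyticWeight ω)
    (hm : AEStronglyMeasurable W volume)
    (hW : ∀ l : ℝ, 0 < l → Integrable (fun z => Real.exp (l * (ω ‖z.fst‖ + ω ‖z.snd‖)) * ‖W z‖)) :
    Integrable W := by
  refine (hW 1 one_pos).mono' hm (Filter.Eventually.of_forall fun z => ?_)
  refine le_mul_of_one_le_left (norm_nonneg _) (Real.one_le_exp ?_)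
  have h1 := hω.nonneg ‖z.fst‖ (norm_nonneg _)
  have h2 := hω.nonneg ‖z.snd‖ (norm_nonneg _)
  linarith

/-- The map σ serves both components: the first for the synthesized function, the second for its
Fourier transform. -/
theorem exists_integral_norm_mul_norm_le (hω : IsNonquasianalyticWeight ω)
    (hW : ∀ l : ℝ, 0 < l → Integrable (fun z => Real.exp (l * (ω ‖z.fst‖ + ω ‖z.snd‖)) * ‖W z‖))
    {g : E → ℂ} (hg : RapidlyDecreasing ω g) {σ : WithLp 2 (E × E) → E}
    (hσ : ∀ z, ω ‖σ z‖ ≤ ω ‖z.fst‖ + ω ‖z.snd‖) {l : ℝ} (hl : 0 < l) :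
    ∃ C : ℝ, ∀ r : E, ∫ z, ‖W z‖ * ‖g (r - (2 : ℝ) • σ z)‖ ≤ C * Real.exp (-(l * ω ‖r‖)) := by
  obtain ⟨C, k, hC0, hk, hC⟩ := hg.exists_norm_sub_two_smul_le hω hl
  refine ⟨C * ∫ z, Real.exp (k * (ω ‖z.fst‖ + ω ‖z.snd‖)) * ‖W z‖, fun r => ?_⟩
  rw [mul_right_comm, ← integral_const_mul]
  refine integral_mono_of_nonneg (Filter.Eventually.of_forall fun z => by positivity)
    ((hW k hk).const_mul _) (Filter.Eventually.of_forall fun z => ?_)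
  have h1 : Real.exp (k * ω ‖σ z‖) ≤ Real.exp (k * (ω ‖z.fst‖ + ω ‖z.snd‖)) := by
    gcongr
    exact hσ z
  calc ‖W z‖ * ‖g (r - (2 : ℝ) • σ z)‖
      ≤ ‖W z‖ * (C * Real.exp (-(l * ω ‖r‖)) *
        Real.exp (k * (ω ‖z.fst‖ + ω ‖z.snd‖))) := by
        gcongr
        exact (hC r (σ z)).trans (by gcongr)
    _ = _ := by ring

theorem continuous_wignerSynthesis (hω : IsNonquasianalyticWeight ω) (hW : Integrable W)
    (hθ : MemBeurling ω θ) : Continuous (wignerSynthesis W θ) := by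
  obtain ⟨C, -, hC⟩ := hθ.rapidlyDecreasing.exists_bound hω
  have hθc := hθ.continuous
  refine continuous_of_dominated (bound := fun z => ‖W z‖ * C)
    (fun r => hW.1.mul (Continuous.aestronglyMeasurable (by fun_prop)))
    (fun r => Filter.Eventually.of_forall fun z => ?_) (hW.norm.mul_const C)
    (Filter.Eventually.of_forall fun z => by fun_prop)
  rw [norm_mul, norm_mul, norm_exp_neg_I_mul_ofReal, one_mul]
  gcongr
  exact hC _

theorem norm_wignerSynthesis_le (W : WithLp 2 (E × E) → ℂ) (θ : E → ℂ) (r : E) :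
    ‖wignerSynthesis W θ r‖ ≤ ∫ z, ‖W z‖ * ‖θ (r - (2 : ℝ) • z.fst)‖ := by
  refine (norm_integral_le_integral_norm _).trans (le_of_eq ?_)
  simp only [norm_mul, norm_exp_neg_I_mul_ofReal, one_mul]

/-- The modulation e^{2i⟨r, ξ⟩} of the window becomes a translation of its Fourier transform by 2ξ,
so û has the same shape as u with the roles of x and ξ exchanged. -/
theorem norm_fourierHat_wignerSynthesis_le (hω : IsNonquasianalyticWeight ω)
    (hm : AEStronglyMeasurable W volume)
    (hW : ∀ l : ℝ, 0 < l → Integrable (fun z => Real.exp (l * (ω ‖z.fst‖ + ω ‖z.snd‖)) * ‖W z‖))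
    (hθ : MemBeurling ω θ) (η : E) :
    ‖fourierHat (wignerSynthesis W θ) η‖ ≤
      ∫ z, ‖W z‖ * ‖fourierHat θ (η - (2 : ℝ) • z.snd)‖ := by
  have hθc := hθ.continuous
  set G : E → WithLp 2 (E × E) → ℂ := fun r z =>
    Complex.exp (-(Complex.I * ((inner ℝ r η : ℝ) : ℂ))) * (W z *
      (Complex.exp (-(Complex.I * ((inner ℝ (r - z.fst) ((-2 : ℝ) • z.snd) : ℝ) : ℂ))) *
        θ (r - (2 : ℝ) • z.fst))) with hG
  obtain ⟨m, hm0, hint⟩ := hω.exists_integrable_exp (volume : Measure E)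
  obtain ⟨C, k, hC0, hk, hC⟩ := hθ.rapidlyDecreasing.exists_norm_sub_two_smul_le hω hm0
  have hGi : Integrable (Function.uncurry G) (volume.prod volume) := by
    refine ((hint.const_mul C).mul_prod (hW k hk)).mono' ?_
      (Filter.Eventually.of_forall fun p => ?_)
    · exact (Continuous.aestronglyMeasurable (by fun_prop)).mul
        (hm.comp_snd.mul (Continuous.aestronglyMeasurable (by fun_prop)))
    · simp only [Function.uncurry, hG, norm_mul, norm_exp_neg_I_mul_ofReal, one_mul]
      have h2 := hω.nonneg ‖p.2.snd‖ (norm_nonneg _)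
      calc ‖W p.2‖ * ‖θ (p.1 - (2 : ℝ) • p.2.fst)‖
          ≤ ‖W p.2‖ * (C * Real.exp (-(m * ω ‖p.1‖)) *
            Real.exp (k * (ω ‖p.2.fst‖ + ω ‖p.2.snd‖))) := by
            gcongr
            exact (hC _ _).trans (by gcongr; linarith)
        _ = _ := by ring
  have e1 : fourierHat (wignerSynthesis W θ) η = ∫ r, ∫ z, G r z := by
    rw [fourierHat]
    refine integral_congr_ae (Filter.Eventually.of_forall fun r => ?_)
    simp only [hG, wignerSynthesis]
    rw [integral_const_mul]
  have e2 : ∀ z, ∫ r, G r z = W z * (Complex.exp (Complex.I *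
      ((2 * inner ℝ z.fst (z.snd - η) : ℝ) : ℂ)) * fourierHat θ (η - (2 : ℝ) • z.snd)) := by
    intro z
    rw [fourierHat, ← integral_const_mul, ← integral_const_mul,
      ← integral_add_right_eq_self _ ((2 : ℝ) • z.fst)]
    refine integral_congr_ae (Filter.Eventually.of_forall fun r => ?_)
    simp only [hG, add_sub_cancel_right]
    have : Complex.exp (-(Complex.I * ((inner ℝ (r + (2 : ℝ) • z.fst) η : ℝ) : ℂ))) *
        Complex.exp (-(Complex.I * ((inner ℝ (r + (2 : ℝ) • z.fst - z.fst)
          ((-2 : ℝ) • z.snd) : ℝ) : ℂ))) =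
        Complex.exp (Complex.I * ((2 * inner ℝ z.fst (z.snd - η) : ℝ) : ℂ)) *
        Complex.exp (-(Complex.I * ((inner ℝ r (η - (2 : ℝ) • z.snd) : ℝ) : ℂ))) := by
      rw [← Complex.exp_add, ← Complex.exp_add]
      congr 1
      simp only [inner_add_left, inner_sub_left, inner_sub_right, inner_smul_right,
        inner_smul_left]
      push_cast
      simp only [conj_trivial]
      push_cast
      ring
    linear_combination (W z * θ r) * this
  rw [e1, integral_integral_swap hGi]
  refine (norm_integral_le_integral_norm _).trans (le_of_eq ?_)
  refine integral_congr_ae (Filter.Eventually.of_forall fun z => ?_)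
  simp only [e2, norm_mul, norm_exp_I_mul_ofReal, one_mul]

theorem memBeurling_wignerSynthesis (hω : IsNonquasianalyticWeight ω)
    (hm : AEStronglyMeasurable W volume)
    (hW : ∀ l : ℝ, 0 < l → Integrable (fun z => Real.exp (l * (ω ‖z.fst‖ + ω ‖z.snd‖)) * ‖W z‖))
    (hθ : MemBeurling ω θ) : MemBeurling ω (wignerSynthesis W θ) := by
  refine memBeurling_of_rapidlyDecreasing hω (continuous_wignerSynthesis hω
    (integrable_of_integrable_exp_mul_norm hω hm hW) hθ) (fun l hl => ?_) (fun l hl => ?_)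
  · obtain ⟨C, hC⟩ := exists_integral_norm_mul_norm_le hω hW hθ.rapidlyDecreasing
      (σ := fun z => z.fst) (fun z => by
        have := hω.nonneg ‖z.snd‖ (norm_nonneg _)
        linarith) hl
    exact ⟨C, fun r => (norm_wignerSynthesis_le W θ r).trans (hC r)⟩
  · obtain ⟨C, hC⟩ := exists_integral_norm_mul_norm_le hω hW hθ.rapidlyDecreasing_hat
      (σ := fun z => z.snd) (fun z => by
        have := hω.nonneg ‖z.fst‖ (norm_nonneg _)
        linarith) hl
    exact ⟨C, fun η => (norm_fourierHat_wignerSynthesis_le hω hm hW hθ η).trans (hC η)⟩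

theorem integral_mul_crossWigner (hω : IsNonquasianalyticWeight ω) (hW : Integrable W)
    (hφ : MemBeurling ω φ) (hθ : MemBeurling ω θ) :
    ∫ z, W z * crossWigner φ θ z = ∫ r, wignerSynthesis W θ r * φ r := by
  have hφc := hφ.continuous
  have hθc := hθ.continuous
  obtain ⟨C, -, hC⟩ := hθ.rapidlyDecreasing.exists_bound hω
  set G : WithLp 2 (E × E) → E → ℂ := fun z r => W z *
      (Complex.exp (-(Complex.I * ((inner ℝ (r - z.fst) ((-2 : ℝ) • z.snd) : ℝ) : ℂ))) *
        (φ r * θ (r - (2 : ℝ) • z.fst))) with hG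
  have hGi : Integrable (Function.uncurry G) (volume.prod volume) := by
    refine ((hW.norm.const_mul C).mul_prod hφ.integrable.norm).mono' ?_
      (Filter.Eventually.of_forall fun p => ?_)
    · exact hW.1.comp_fst.mul (Continuous.aestronglyMeasurable (by fun_prop))
    · simp only [Function.uncurry, hG, norm_mul, norm_exp_neg_I_mul_ofReal, one_mul]
      calc ‖W p.1‖ * (‖φ p.2‖ * ‖θ (p.2 - (2 : ℝ) • p.1.fst)‖)
          ≤ ‖W p.1‖ * (‖φ p.2‖ * C) := by gcongr; exact hC _
        _ = _ := by ring
  have e1 : ∫ z, W z * crossWigner φ θ z = ∫ z, ∫ r, G z r := by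
    refine integral_congr_ae (Filter.Eventually.of_forall fun z => ?_)
    simp only [hG, crossWigner, crossAmbiguity_eq_integral]
    rw [integral_const_mul]
  rw [e1, integral_integral_swap hGi]
  refine integral_congr_ae (Filter.Eventually.of_forall fun r => ?_)
  simp only [wignerSynthesis]
  rw [← integral_mul_const]
  refine integral_congr_ae (Filter.Eventually.of_forall fun z => ?_)
  simp only [hG]
  ring

theorem Ultradistribution.pair_const_mul (f : Ultradistribution E ω) (c : ℂ)
    (hφ : MemBeurling ω φ) : f.pair (fun x => c * φ x) = c * f ⟨φ, hφ⟩ := by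
  have h : MemBeurling ω (fun x => c * φ x) := hφ.smul c
  rw [Ultradistribution.pair, dif_pos h]
  exact map_smul f c (⟨φ, hφ⟩ : BeurlingSpace E ω)

/-- The window conj(χ(-s)) compensates the reflection in `wignerTest_crossWigner` and the
conjugation in `pairConj`, so f is applied to χ itself. -/
theorem Ultradistribution.wigner_crossWigner (hω : IsNonquasianalyticWeight ω)
    (f : Ultradistribution E ω) {χ : E → ℂ} (hφ : MemBeurling ω φ) (hχ : MemBeurling ω χ)
    (hΦ : MemBeurling ω (crossWigner φ fun s => conj (χ (-s)))) :
    f.wigner ⟨crossWigner φ fun s => conj (χ (-s)), hΦ⟩ =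
      (Real.pi : ℂ) ^ Module.finrank ℝ E * conj (f ⟨χ, hχ⟩) * f ⟨φ, hφ⟩ := by
  have hθ : MemBeurling ω (fun s => conj (χ (-s))) := (hχ.comp_neg hω).conj_comp hω
  have e : ∀ y, f.pairConj (fun s => wignerTest (crossWigner φ fun s => conj (χ (-s))) y s) =
      ((Real.pi : ℂ) ^ Module.finrank ℝ E * conj (f ⟨χ, hχ⟩)) * φ y := by
    intro y
    have : (fun s => conj (wignerTest (crossWigner φ fun s => conj (χ (-s))) y s)) =
        fun s => conj ((Real.pi : ℂ) ^ Module.finrank ℝ E * φ y) * χ s := by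
      funext s
      rw [wignerTest_crossWigner hω hφ hθ]
      simp only [neg_neg, map_mul, Complex.conj_conj]
      ring
    rw [Ultradistribution.pairConj, this, f.pair_const_mul _ hχ, map_mul, Complex.conj_conj]
    ring
  have h : f.wigner ⟨crossWigner φ fun s => conj (χ (-s)), hΦ⟩ = f.pair fun y =>
      f.pairConj (fun s => wignerTest (crossWigner φ fun s => conj (χ (-s))) y s) := rfl
  rw [h, funext e, f.pair_const_mul _ hφ]

end Synthesis

theorem lemma3p13 (d : ℕ) (ω : ℝ → ℝ) (hω : IsNonquasianalyticWeight ω)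
    (p q : ℝ≥0∞) (hp : 1 ≤ p) (hq : 1 ≤ q)
    (f : Ultradistribution (EuclideanSpace ℝ (Fin d)) ω)
    (W : WithLp 2 (EuclideanSpace ℝ (Fin d) × EuclideanSpace ℝ (Fin d)) → ℂ)
    (hW : IsGivenBy f.wigner W)
    (hmem : ∀ l m : ℝ, 0 < l → 0 < m →
      MemMixedLp p q (fun z =>
        ((Real.exp (l * ω ‖z.fst‖ + m * ω ‖z.snd‖) : ℝ) : ℂ) * W z)) :
    ∃ u : EuclideanSpace ℝ (Fin d) → ℂ, MemBeurling ω u ∧ IsGivenBy f u := by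
  by_cases hf : ∃ χ, f χ ≠ 0
  · obtain ⟨⟨χ, hχ⟩, hfχ⟩ := hf
    have hm := aestronglyMeasurable_of_memMixedLp hω hmem
    have hexp : ∀ l : ℝ, 0 < l → Integrable (fun z => Real.exp (l * (ω ‖z.fst‖ + ω ‖z.snd‖)) *
        ‖W z‖) := fun l hl => integrable_exp_mul_norm_of_memMixedLp hω hp hq hmem hl
    have hWi := integrable_of_integrable_exp_mul_norm hω hm hexp
    have hθ : MemBeurling ω (fun s => conj (χ (-s))) := (hχ.comp_neg hω).conj_comp hω
    -- This is the factor by which testing `Wig f` on the cross Wigner functions multiplies f; ⟨f,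
    -- χ⟩ ≠ 0 makes it invertible.
    set c : ℂ := (Real.pi : ℂ) ^ Module.finrank ℝ (EuclideanSpace ℝ (Fin d)) * conj (f ⟨χ, hχ⟩)
      with hc
    have hc0 : c ≠ 0 := mul_ne_zero (pow_ne_zero _ (by exact_mod_cast Real.pi_ne_zero))
      ((map_ne_zero _).2 hfχ)
    have hu : MemBeurling ω (c⁻¹ • wignerSynthesis W fun s => conj (χ (-s))) :=
      (memBeurling_wignerSynthesis hω hm hexp hθ).smul _
    refine ⟨_, hu, fun φ => ⟨?_, ?_⟩⟩
    · obtain ⟨C, -, hC⟩ := hu.rapidlyDecreasing.exists_bound hω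
      exact φ.memBeurling.integrable.bdd_mul (c := C) hu.continuous.aestronglyMeasurable
        (Filter.Eventually.of_forall hC)
    · have hΦ := memBeurling_crossWigner hω φ.memBeurling hθ
      have key := (hW ⟨_, hΦ⟩).2
      rw [f.wigner_crossWigner hω φ.memBeurling hχ hΦ, ← hc] at key
      have key2 := integral_mul_crossWigner hω hWi φ.memBeurling hθ
      -- Two evaluations of the Wigner pairing on the same test function: the factorization through
      -- f, and the integral against W.
      have h : c * f φ = ∫ r, wignerSynthesis W (fun s => conj (χ (-s))) r * φ r :=
        key.trans key2
      simp only [Pi.smul_apply, smul_eq_mul, mul_assoc]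
      rw [integral_const_mul, ← h, inv_mul_cancel_left₀ hc0]
  · push Not at hf
    refine ⟨0, MemBeurling.zero ω, fun φ => ⟨by simp, ?_⟩⟩
    simp [hf φ]
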